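/- **Alignment types of pp waves.** Let $n\ge 4$ and let $(M,g)$ be a smooth $n$-dimensional manifold with a smooth metric of signature $(-,+,\dots,+)$, Levi-Civita connection $\nabla$, Riemann tensor $R_{abcd}$, Ricci tensor $R_{ab}=R^c{}_{acb}$, scalar curvature $R$ and Weyl tensor $C_{abcd}$. Suppose $(M,g)$ is a *pp wave*, i.e. it carries a smooth, nowhere vanishing, null vector field $\ell$ with $\nabla\ell=0$. *Terminology.* A null frame at a point is a basis $e_{(0)}=\boldsymbol\ell,\ e_{(1)}=\boldsymbol n,\ e_{(i)}=m_{(i)}$ ($i=2,\dots,n-1$) of the tangent space with $\boldsymbol\ell\cdot\boldsymbol\ell=\boldsymbol n\cdot\boldsymbol n=0$, $\boldsymbol\ell\cdot\boldsymbol n=1$, $\boldsymbol\ell\cdot m_{(i)}=\boldsymbol n\cdot m_{(i)}=0$, $m_{(i)}\cdot m_{(j)}=\delta_{ij}$. The boost weight (b.w.) of a frame component $T_{\hat a\dots\hat b}$ is the number of indices $0$ minus the number of indices $1$. A tensor at a point is of type II (resp. D, III) if in some null frame its nonzero components all have b.w. $\le 0$ (resp. $=0$, $<0$); the Weyl tensor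 is of type N if in some null frame only components of b.w. $-2$ occur. Put $\Phi=C_{0101}$, $\Phi_{ij}=C_{0i1j}$, $\Psi'_i=C_{101i}$. In a frame as above, the subtypes (a), (b), (d) of types II and D require, respectively, $\Phi=0$; $\Phi_{(ij)}=\frac{\Phi}{n-2}\delta_{ij}$; $\Phi_{[ij]}=0$; several letters mean that all the respective conditions hold. Type II$'$(abd) is type II(abd) with in addition $\Psi'_i=0$; type III(a) is type III with $\Psi'_i=0$. Unless called genuine, a type includes the more special ones (for instance N is a special case of III(a)). Genuine II$'$(abd) means II$'$(abd) and neither D nor III; genuine III(a) means III(a) and not N. The metric is VSI if all scalar polynomial curvature invariants of all orders (complete contractions, by the metric, of products of at least one factor among the Riemann tensor and its covariant derivatives, and their linear combinations) vanish at every point. Then: 1. At every point there is a null frame with $e_{(0)}=\ell$ in which all components of the Weyl tensor and of the Ricci tensor of positive b.w. vanish and $\Phi_{[ij]}=0$ (so the Weyl type is II(d) and the Ricci type is II, or more special), and $R_{ab}\ell^b=0$. 2. The metric is nowhere properly Einstein: at no point do $R_{ab}=\frac{R}{n}g_{ab}$ and $R\neq 0$ hold. 3. If $(M,g)$ is Ricci-flat,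 then at every point where the Weyl tensor does not vanish the Weyl type is (i) N, if $n=4$; (ii) genuine III(a) or N, if $n=5$; (iii) genuine II$'$(abd), D(abd), genuine III(a), or N, if $n\ge 6$. 4. If $(M,g)$ is Ricci-flat and at every point the Weyl tensor vanishes or is of type III(a) or N, then $(M,g)$ is VSI. -/

import Mathlib

open scoped Manifold ContDiff

noncomputable section

namespace PPWave

/-! ## Tensor calculus in a coordinate domain -/

/-- The coordinate space. -/
abbrev Coord (n : ℕ) := EuclideanSpace ℝ (Fin n)

/-- Components `T_{a₁ … a_k}` of a covariant tensor of rank `k` in dimension `n`. -/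
abbrev Tensor (n k : ℕ) := (Fin k → Fin n) → ℝ

/-- Component functions of a covariant tensor field of rank `k`. -/
abbrev Field (n k : ℕ) := Coord n → Tensor n k

/-- The components `g_{ab}` of a metric as functions of the coordinates. -/
abbrev MetricField (n : ℕ) := Coord n → Matrix (Fin n) (Fin n) ℝ

/-- The partial derivative `∂_i f`. -/
def pd {n : ℕ} (i : Fin n) (f : Coord n → ℝ) (y : Coord n) : ℝ :=
  fderiv ℝ f y (EuclideanSpace.single i 1)

/-- The Christoffel symbols `Γ^a_{bc}` of the Levi-Civita connection. -/
def christoffel {n : ℕ} (g : MetricField n) (a b c : Fin n) (y : Coord n) : ℝ :=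
  (1 / 2) * ∑ d, (g y)⁻¹ a d *
    (pd b (fun z => g z d c) y + pd c (fun z => g z d b) y - pd d (fun z => g z b c) y)

/-- `R^a_{bcd} = ∂_c Γ^a_{db} - ∂_d Γ^a_{cb} + Γ^a_{ce} Γ^e_{db} - Γ^a_{de} Γ^e_{cb}`. -/
def riemannUp {n : ℕ} (g : MetricField n) (a b c d : Fin n) (y : Coord n) : ℝ :=
  pd c (christoffel g a d b) y - pd d (christoffel g a c b) y
    + ∑ e, (christoffel g a c e y * christoffel g e d b y
      - christoffel g a d e y * christoffel g e c b y)

/-- The Riemann tensor `R_{abcd}`. -/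
def riemann {n : ℕ} (g : MetricField n) : Field n 4 := fun y s =>
  ∑ e, g y (s 0) e * riemannUp g e (s 1) (s 2) (s 3) y

/-- The Ricci tensor `R_{ab} = R^c_{acb}`. -/
def ricci {n : ℕ} (g : MetricField n) : Field n 2 := fun y s =>
  ∑ c, riemannUp g c (s 0) c (s 1) y

/-- The Ricci scalar `R = g^{ab} R_{ab}`. -/
def scalarCurvature {n : ℕ} (g : MetricField n) (y : Coord n) : ℝ :=
  ∑ a, ∑ b, (g y)⁻¹ a b * ricci g y ![a, b]

/-- The Weyl tensor `C_{abcd}` (used in dimension `n ≥ 4`). -/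
def weyl {n : ℕ} (g : MetricField n) : Field n 4 := fun y s =>
  riemann g y s
    - (1 / ((n : ℝ) - 2)) *
      (g y (s 0) (s 2) * ricci g y ![s 1, s 3] - g y (s 0) (s 3) * ricci g y ![s 1, s 2]
        - g y (s 1) (s 2) * ricci g y ![s 0, s 3] + g y (s 1) (s 3) * ricci g y ![s 0, s 2])
    + (scalarCurvature g y / (((n : ℝ) - 1) * ((n : ℝ) - 2))) *
      (g y (s 0) (s 2) * g y (s 1) (s 3) - g y (s 0) (s 3) * g y (s 1) (s 2))

/-- The covariant derivative `T_{a₁ … a_k ; b}`; the differentiation index `b` is the last one. -/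
def covDeriv {n k : ℕ} (g : MetricField n) (T : Field n k) : Field n (k + 1) := fun y s =>
  pd (s (Fin.last k)) (fun z => T z (Fin.init s)) y
    - ∑ r : Fin k, ∑ d : Fin n,
      christoffel g d (s (Fin.last k)) (s r.castSucc) y
        * T y (Function.update (Fin.init s) r d)

/-- The `p`-th covariant derivative of the Riemann tensor. -/
def riemannDeriv {n : ℕ} (g : MetricField n) : (p : ℕ) → Field n (4 + p)
  | 0 => riemann g
  | p + 1 => covDeriv g (riemannDeriv g p)

/-! ## Scalar polynomial curvature invariants -/

/-- A complete contraction of `∇^{k₁} Riem ⊗ ⋯ ⊗ ∇^{k_m} Riem`. The slots of the product, indexed by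
`Σ i, Fin (4 + k i)`, are grouped into `q` pairs by the bijection `σ`, and the two slots of each
pair are contracted by the inverse metric. -/
def contraction {n m q : ℕ} (g : MetricField n) (k : Fin m → ℕ)
    (σ : (Σ i : Fin m, Fin (4 + k i)) ≃ Fin q ⊕ Fin q) (y : Coord n) : ℝ :=
  ∑ a : Fin q ⊕ Fin q → Fin n,
    (∏ j : Fin q, (g y)⁻¹ (a (Sum.inl j)) (a (Sum.inr j)))
      * ∏ i : Fin m, riemannDeriv g (k i) y (fun r => a (σ ⟨i, r⟩))

/-- The scalar polynomial curvature invariants of order (at most) `p`, without constant term: the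
linear combinations of complete contractions of products of at least one factor among the Riemann
tensor and its covariant derivatives up to order `p`. A product of such contractions is a
contraction of the same kind. -/
def curvatureInvariants {n : ℕ} (g : MetricField n) (p : ℕ) : Submodule ℝ (Coord n → ℝ) :=
  Submodule.span ℝ
    {I | ∃ (m q : ℕ) (k : Fin m → ℕ) (σ : (Σ i : Fin m, Fin (4 + k i)) ≃ Fin q ⊕ Fin q),
      0 < m ∧ (∀ i, k i ≤ p) ∧ I = contraction g k σ}

/-! ## Null frames, boost weights and alignment types at a point -/

/-- The scalar product `G_{ab} u^a v^b`. -/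
def dot {n : ℕ} (G : Matrix (Fin n) (Fin n) ℝ) (u v : Fin n → ℝ) : ℝ :=
  ∑ a, ∑ b, G a b * u a * v b

/-- A null frame `e₍₀₎ = l`, `e₍₁₎ = nn`, `e₍ᵢ₎ = m i` (with `n - 2` spacelike vectors). -/
structure NullFrame {n : ℕ} (G : Matrix (Fin n) (Fin n) ℝ) where
  l : Fin n → ℝ
  nn : Fin n → ℝ
  m : Fin (n - 2) → Fin n → ℝ
  l_l : dot G l l = 0
  nn_nn : dot G nn nn = 0
  l_nn : dot G l nn = 1
  l_m : ∀ i, dot G l (m i) = 0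
  nn_m : ∀ i, dot G nn (m i) = 0
  m_m : ∀ i j, dot G (m i) (m j) = if i = j then 1 else 0

/-- Frame indices: `zero` for `l`, `one` for `nn`, `sp i` for `m i`. -/
inductive FrameIndex (n : ℕ)
  | zero : FrameIndex n
  | one : FrameIndex n
  | sp (i : Fin (n - 2)) : FrameIndex n

/-- The contribution of one frame index to the boost weight. -/
def FrameIndex.weight {n : ℕ} : FrameIndex n → ℤ
  | .zero => 1
  | .one => -1
  | .sp _ => 0

/-- The boost weight of a frame component: number of `0`s minus number of `1`s. -/
def boostWeight {n k : ℕ} (I : Fin k → FrameIndex n) : ℤ := ∑ r, (I r).weight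

namespace NullFrame

variable {n : ℕ} {G : Matrix (Fin n) (Fin n) ℝ}

/-- The frame vector with a given index. -/
def vec (F : NullFrame G) : FrameIndex n → Fin n → ℝ
  | .zero => F.l
  | .one => F.nn
  | .sp i => F.m i

/-- The frame component `T(e_{I 1}, …, e_{I k})`. -/
def comp {k : ℕ} (F : NullFrame G) (T : Tensor n k) (I : Fin k → FrameIndex n) : ℝ :=
  ∑ s : Fin k → Fin n, (∏ r, F.vec (I r) (s r)) * T s

/-- All nonzero frame components of `T` have boost weight in `S`. -/
def WeightsIn {k : ℕ} (F : NullFrame G) (T : Tensor n k) (S : Set ℤ) : Prop :=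
  ∀ I : Fin k → FrameIndex n, F.comp T I ≠ 0 → boostWeight I ∈ S

/-- `Φ_{ij} = C_{0i1j}`. -/
def Phi2 (F : NullFrame G) (C : Tensor n 4) (i j : Fin (n - 2)) : ℝ :=
  F.comp C ![.zero, .sp i, .one, .sp j]

/-- `Φ = C_{0101}`. -/
def Phi0 (F : NullFrame G) (C : Tensor n 4) : ℝ :=
  F.comp C ![.zero, .one, .zero, .one]

/-- `Ψ'_i = C_{101i}`. -/
def Psi' (F : NullFrame G) (C : Tensor n 4) (i : Fin (n - 2)) : ℝ :=
  F.comp C ![.one, .zero, .one, .sp i]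

/-- The condition (a) on the boost weight `0` components: `Φ = 0`. -/
def SubA (F : NullFrame G) (C : Tensor n 4) : Prop := F.Phi0 C = 0

/-- The condition (b) on the boost weight `0` components: the tracefree part
`Φ_{(ij)} - Φ δ_{ij} / (n - 2)` of the symmetric part of `Φ_{ij}` vanishes. -/
def SubB (F : NullFrame G) (C : Tensor n 4) : Prop :=
  ∀ i j, (F.Phi2 C i j + F.Phi2 C j i) / 2
    - (F.Phi0 C / ((n : ℝ) - 2)) * (if i = j then 1 else 0) = 0

/-- The condition (d) on the boost weight `0` components: `Φ_{[ij]} = 0`. -/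
def SubD (F : NullFrame G) (C : Tensor n 4) : Prop :=
  ∀ i j, (F.Phi2 C i j - F.Phi2 C j i) / 2 = 0

end NullFrame

/-! The types below are those of a Weyl tensor `C` with respect to the scalar product `G`; each of
them means "this type or more special, but not zero", unless it is called genuine. -/

section Types

variable {n : ℕ} (G : Matrix (Fin n) (Fin n) ℝ) (C : Tensor n 4)

/-- Type D: in some null frame only components of boost weight `0` occur. -/
def TypeD : Prop := C ≠ 0 ∧ ∃ F : NullFrame G, F.WeightsIn C {0}

/-- Type D(abd). -/
def TypeDabd : Prop :=
  C ≠ 0 ∧ ∃ F : NullFrame G, F.WeightsIn C {0} ∧ F.SubA C ∧ F.SubB C ∧ F.SubD C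

/-- Type III: in some null frame only components of negative boost weight occur. -/
def TypeIII : Prop := C ≠ 0 ∧ ∃ F : NullFrame G, F.WeightsIn C (Set.Iio 0)

/-- Type III(a): in addition `Ψ'_i = 0`. -/
def TypeIIIa : Prop :=
  C ≠ 0 ∧ ∃ F : NullFrame G, F.WeightsIn C (Set.Iio 0) ∧ ∀ i, F.Psi' C i = 0

/-- Type N: in some null frame only components of boost weight `-2` occur. -/
def TypeN : Prop := C ≠ 0 ∧ ∃ F : NullFrame G, F.WeightsIn C {-2}

/-- Type II'(abd): only components of boost weight `≤ 0` occur, the conditions (a), (b), (d) hold,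
and in addition `Ψ'_i = 0`. -/
def TypeII'abd : Prop :=
  C ≠ 0 ∧ ∃ F : NullFrame G, F.WeightsIn C (Set.Iic 0) ∧ F.SubA C ∧ F.SubB C ∧ F.SubD C ∧
    ∀ i, F.Psi' C i = 0

/-- Genuine type III(a): not of type N. -/
def GenuineTypeIIIa : Prop := TypeIIIa G C ∧ ¬ TypeN G C

/-- Genuine type II'(abd): neither of type D nor of type III (hence not of type N). -/
def GenuineTypeII'abd : Prop := TypeII'abd G C ∧ ¬ TypeD G C ∧ ¬ TypeIII G C

end Types

/-! ## Lorentzian manifolds and pp waves -/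

section Manifold

variable {n : ℕ} {M : Type*} [TopologicalSpace M] [ChartedSpace (Coord n) M]

/-- The coordinate vector `∂/∂y^i` at the point with coordinates `y` in the chart `e`. -/
def coordVec (e : OpenPartialHomeomorph M (Coord n)) (y : Coord n) (i : Fin n) :
    TangentSpace (𝓡 n) (e.symm y) :=
  mfderiv (𝓡 n) (𝓡 n) e.symm y (EuclideanSpace.single i (1 : ℝ) : Coord n)

/-- The components in the chart `e` of a tangent vector `v` at `p`. -/
def vecComp (e : OpenPartialHomeomorph M (Coord n)) (p : M) (v : TangentSpace (𝓡 n) p) :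
    Fin n → ℝ :=
  WithLp.ofLp (p := 2) (V := Fin n → ℝ) (mfderiv (𝓡 n) (𝓡 n) e p v)

/-- The components in the chart `e`, as functions of the coordinates, of a vector field. -/
def fieldComp (e : OpenPartialHomeomorph M (Coord n)) (X : ∀ p : M, TangentSpace (𝓡 n) p)
    (y : Coord n) : Fin n → ℝ :=
  vecComp e (e.symm y) (X (e.symm y))

variable (n M) in
/-- A smooth metric of signature `(-, +, …, +)` on a manifold of dimension `n`. -/
structure LorentzMetric where
  val : ∀ p : M, TangentSpace (𝓡 n) p →ₗ[ℝ] TangentSpace (𝓡 n) p →ₗ[ℝ] ℝ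
  symm : ∀ p u v, val p u v = val p v u
  lorentzian : ∀ p, ∃ b : Module.Basis (Fin n) ℝ (TangentSpace (𝓡 n) p), ∀ i j,
    val p (b i) (b j) = if i = j then (if (i : ℕ) = 0 then -1 else 1) else 0
  smooth : ∀ e ∈ atlas (Coord n) M, ∀ i j, ContDiffOn ℝ ∞
    (fun y => val (e.symm y) (coordVec e y i) (coordVec e y j)) e.target

/-- The components `g_{ij}` of the metric in the chart `e`. -/
def LorentzMetric.coord (g : LorentzMetric n M) (e : OpenPartialHomeomorph M (Coord n)) :
    MetricField n :=
  fun y => Matrix.of fun i j => g.val (e.symm y) (coordVec e y i) (coordVec e y j)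

/-- `ℓ` is a covariantly constant null vector field, i.e. it makes `(M, g)` a pp wave. A null
vector is by convention nonzero. -/
structure IsCCNV (g : LorentzMetric n M) (ℓ : ∀ p : M, TangentSpace (𝓡 n) p) : Prop where
  smooth : ∀ e ∈ atlas (Coord n) M, ∀ a, ContDiffOn ℝ ∞ (fun y => fieldComp e ℓ y a) e.target
  ne_zero : ∀ p, ℓ p ≠ 0
  null : ∀ p, g.val p (ℓ p) (ℓ p) = 0
  /-- In every chart `∂_b ℓ^a + Γ^a_{bc} ℓ^c = 0`. -/
  parallel : ∀ e ∈ atlas (Coord n) M, ∀ y ∈ e.target, ∀ a b,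
    pd b (fun z => fieldComp e ℓ z a) y
      + ∑ c, christoffel (g.coord e) a b c y * fieldComp e ℓ y c = 0

/-- The metric is Ricci-flat. -/
def IsRicciFlat (g : LorentzMetric n M) : Prop :=
  ∀ e ∈ atlas (Coord n) M, ∀ y ∈ e.target, ricci (g.coord e) y = 0

/-- The metric is VSI: all scalar polynomial curvature invariants of all orders vanish
everywhere. -/
def IsVSI (g : LorentzMetric n M) : Prop :=
  ∀ e ∈ atlas (Coord n) M, ∀ p : ℕ, ∀ I ∈ curvatureInvariants (g.coord e) p,
    ∀ y ∈ e.target, I y = 0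

end Manifold

end PPWave

end

/-! Everything rests on one fact: a parallel field annihilates the curvature. Differentiating ∇ℓ = 0
once more and using that partial derivatives commute gives R_{abcd} ℓ^b = 0. The symmetries of the
Riemann tensor carry this to every slot (`killedBy_riemann`), whence R_{ab} ℓ^b = 0
(`killedBy_ricci`). In a null frame with e₍₀₎ = ℓ (`NullFrame.exists_nullFrame`) all Riemann and
Ricci components with an index 0 therefore vanish. This excludes positive boost weight, also for the
Weyl tensor, whose correction terms are products of g with Ricci or with g; and Φ_{ij} is built from
R_{ij} and δ_{ij} only, so it is symmetric. A proper Einstein metric would force g_{ab} ℓ^b = 0.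

In the Ricci-flat case Weyl equals Riemann. Since Φ, Φ_{ij} and Ψ'_i carry an index 0, the type is
II'(abd). Up to symmetry only C_{ijkl}, C_{1ijk} and C_{1i1j} survive. The first is a tracefree
curvature tensor in n - 2 Euclidean dimensions, hence zero for n = 4, 5; the second is tracefree too
and vanishes for n = 4. The delicate point is that type D or III is witnessed by a frame unrelated
to ℓ. Contracting with ℓ gives linear relations among the components in that frame, and these still
force the subtypes (`TypeD.typeDabd`, `TypeIII.typeIIIa`).

For VSI, two properties pass from Riemann to all its covariant derivatives: being annihilated by ℓ
in every slot (`killedBy_riemannDeriv`; the differentiation slot needs the second Bianchi identity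
at first order and the Ricci identity afterwards), and vanishing on ℓ^⊥
(`vanishesOnPerp_riemannDeriv`; initially this is type III). A nonzero frame component then has no
index 0 and at least one index 1, while the inverse metric pairs each 1 with a 0, so every complete
contraction vanishes (`contraction_eq_zero`). -/

namespace PPWave

/-! ## Partial derivatives of smooth functions on an open set -/

section PartialDerivatives

variable {n : ℕ} {U : Set (Coord n)} {f h : Coord n → ℝ} {y : Coord n}

theorem differentiableAt_of_smoothOn (hU : IsOpen U) (hf : ContDiffOn ℝ ∞ f U) (hy : y ∈ U) :
    DifferentiableAt ℝ f y :=
  (hf.contDiffAt (hU.mem_nhds hy)).differentiableAt (by simp)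

theorem pd_congr (hU : IsOpen U) (hfh : ∀ z ∈ U, f z = h z) (hy : y ∈ U) (i : Fin n) :
    pd i f y = pd i h y := by
  have : f =ᶠ[nhds y] h := Filter.eventuallyEq_of_mem (hU.mem_nhds hy) hfh
  simp only [pd, this.fderiv_eq]

theorem pd_const (c : ℝ) (i : Fin n) : pd i (fun _ => c) y = 0 := by
  simp [pd]

theorem pd_add (hU : IsOpen U) (hf : ContDiffOn ℝ ∞ f U) (hh : ContDiffOn ℝ ∞ h U) (hy : y ∈ U)
    (i : Fin n) : pd i (fun z => f z + h z) y = pd i f y + pd i h y := by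
  simp only [pd]
  rw [fderiv_fun_add (differentiableAt_of_smoothOn hU hf hy)
    (differentiableAt_of_smoothOn hU hh hy)]
  rfl

theorem pd_sub (hU : IsOpen U) (hf : ContDiffOn ℝ ∞ f U) (hh : ContDiffOn ℝ ∞ h U) (hy : y ∈ U)
    (i : Fin n) : pd i (fun z => f z - h z) y = pd i f y - pd i h y := by
  simp only [pd]
  rw [fderiv_fun_sub (differentiableAt_of_smoothOn hU hf hy)
    (differentiableAt_of_smoothOn hU hh hy)]
  rfl

theorem pd_neg (i : Fin n) : pd i (fun z => - f z) y = - pd i f y := by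
  simp only [pd]
  rw [fderiv_fun_neg]
  rfl

theorem pd_mul (hU : IsOpen U) (hf : ContDiffOn ℝ ∞ f U) (hh : ContDiffOn ℝ ∞ h U) (hy : y ∈ U)
    (i : Fin n) : pd i (fun z => f z * h z) y = pd i f y * h y + f y * pd i h y := by
  simp only [pd]
  rw [fderiv_fun_mul (differentiableAt_of_smoothOn hU hf hy)
    (differentiableAt_of_smoothOn hU hh hy)]
  simp
  ring

theorem pd_sum {ι : Type*} (s : Finset ι) {F : ι → Coord n → ℝ} (hU : IsOpen U)
    (hF : ∀ j ∈ s, ContDiffOn ℝ ∞ (F j) U) (hy : y ∈ U) (i : Fin n) :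
    pd i (fun z => ∑ j ∈ s, F j z) y = ∑ j ∈ s, pd i (F j) y := by
  simp only [pd]
  rw [fderiv_fun_sum fun j hj => differentiableAt_of_smoothOn hU (hF j hj) hy]
  simp

theorem pd_prod {ι : Type*} [DecidableEq ι] (s : Finset ι) {F : ι → Coord n → ℝ} (hU : IsOpen U)
    (hF : ∀ j ∈ s, ContDiffOn ℝ ∞ (F j) U) (hy : y ∈ U) (i : Fin n) :
    pd i (fun z => ∏ j ∈ s, F j z) y
      = ∑ j ∈ s, (∏ k ∈ s.erase j, F k y) * pd i (F j) y := by
  simp only [pd]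
  rw [fderiv_finsetProd fun j hj => differentiableAt_of_smoothOn hU (hF j hj) hy]
  simp

theorem smoothOn_pd (hU : IsOpen U) (hf : ContDiffOn ℝ ∞ f U) (i : Fin n) :
    ContDiffOn ℝ ∞ (pd i f) U :=
  (hf.fderiv_of_isOpen hU (m := ∞) (by simp)).clm_apply contDiffOn_const

theorem pd_comm (hU : IsOpen U) (hf : ContDiffOn ℝ ∞ f U) (hy : y ∈ U) (i j : Fin n) :
    pd i (pd j f) y = pd j (pd i f) y := by
  have hd : DifferentiableAt ℝ (fderiv ℝ f) y :=
    ((hf.fderiv_of_isOpen hU (m := ∞) (by simp)).contDiffAt (hU.mem_nhds hy)).differentiableAt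
      (by simp)
  have key : ∀ i j : Fin n, pd i (pd j f) y
      = fderiv ℝ (fderiv ℝ f) y (EuclideanSpace.single i 1) (EuclideanSpace.single j 1) := by
    intro i j
    change fderiv ℝ (fun z => fderiv ℝ f z (EuclideanSpace.single j 1)) y _ = _
    rw [fderiv_clm_apply hd (differentiableAt_const _)]
    simp
  rw [key, key]
  exact ((hf.contDiffAt (hU.mem_nhds hy)).isSymmSndFDerivAt (by
    simpa using ENat.LEInfty.out)).eq _ _

end PartialDerivatives

/-! ## Smooth metrics on an open set of coordinates -/

/-- `g` is a smooth nondegenerate metric on the open set `U`. -/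
structure IsMetricOn {n : ℕ} (g : MetricField n) (U : Set (Coord n)) : Prop where
  isOpen : IsOpen U
  smooth : ∀ a b, ContDiffOn ℝ ∞ (fun y => g y a b) U
  symm : ∀ y a b, g y a b = g y b a
  det_ne_zero : ∀ y ∈ U, (g y).det ≠ 0

theorem smoothOn_det {n m : ℕ} {U : Set (Coord n)} {A : Coord n → Matrix (Fin m) (Fin m) ℝ}
    (hA : ∀ a b, ContDiffOn ℝ ∞ (fun y => A y a b) U) :
    ContDiffOn ℝ ∞ (fun y => (A y).det) U := by
  simp only [Matrix.det_apply]
  refine ContDiffOn.sum fun σ _ => ?_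
  exact (contDiffOn_prod fun i _ => hA _ _).const_smul (Equiv.Perm.sign σ)

namespace IsMetricOn

variable {n : ℕ} {g : MetricField n} {U : Set (Coord n)} {y : Coord n}

/-- Cramer's rule: an entry of the inverse is a determinant in the metric components divided by the
nonvanishing det g. -/
theorem smooth_inv (hg : IsMetricOn g U) (a b : Fin n) :
    ContDiffOn ℝ ∞ (fun y => (g y)⁻¹ a b) U := by
  simp only [Matrix.inv_def, Matrix.smul_apply, Ring.inverse_eq_inv', smul_eq_mul,
    Matrix.adjugate_apply]
  refine ((smoothOn_det hg.smooth).inv hg.det_ne_zero).mul (smoothOn_det fun i j => ?_)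
  by_cases h : i = b
  · subst h
    simpa using contDiffOn_const
  · simpa [Matrix.updateRow_apply, h] using hg.smooth i j

theorem smooth_christoffel (hg : IsMetricOn g U) (a b c : Fin n) :
    ContDiffOn ℝ ∞ (christoffel g a b c) U := by
  refine contDiffOn_const.mul (ContDiffOn.sum fun d _ => (hg.smooth_inv a d).mul ?_)
  exact ((smoothOn_pd hg.isOpen (hg.smooth d c) b).add
    (smoothOn_pd hg.isOpen (hg.smooth d b) c)).sub (smoothOn_pd hg.isOpen (hg.smooth b c) d)

theorem smooth_riemannUp (hg : IsMetricOn g U) (a b c d : Fin n) :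
    ContDiffOn ℝ ∞ (riemannUp g a b c d) U := by
  refine ((smoothOn_pd hg.isOpen (hg.smooth_christoffel _ _ _) _).sub
    (smoothOn_pd hg.isOpen (hg.smooth_christoffel _ _ _) _)).add
    (ContDiffOn.sum fun e _ => ?_)
  exact ((hg.smooth_christoffel _ _ _).mul (hg.smooth_christoffel _ _ _)).sub
    ((hg.smooth_christoffel _ _ _).mul (hg.smooth_christoffel _ _ _))

theorem smooth_riemann (hg : IsMetricOn g U) (s : Fin 4 → Fin n) :
    ContDiffOn ℝ ∞ (fun y => riemann g y s) U :=
  ContDiffOn.sum fun _ _ => (hg.smooth _ _).mul (hg.smooth_riemannUp _ _ _ _)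

theorem smooth_covDeriv (hg : IsMetricOn g U) {k : ℕ} {T : Field n k}
    (hT : ∀ s, ContDiffOn ℝ ∞ (fun y => T y s) U) (s : Fin (k + 1) → Fin n) :
    ContDiffOn ℝ ∞ (fun y => covDeriv g T y s) U := by
  refine (smoothOn_pd hg.isOpen (hT _) _).sub
    (ContDiffOn.sum fun r _ => ContDiffOn.sum fun d _ => ?_)
  exact (hg.smooth_christoffel _ _ _).mul (hT _)

theorem smooth_riemannDeriv (hg : IsMetricOn g U) (p : ℕ) (s : Fin (4 + p) → Fin n) :
    ContDiffOn ℝ ∞ (fun y => riemannDeriv g p y s) U := by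
  induction p with
  | zero => exact hg.smooth_riemann s
  | succ p ih => exact hg.smooth_covDeriv ih s

theorem christoffel_symm (hg : IsMetricOn g U) (a b c : Fin n) :
    christoffel g a b c = christoffel g a c b := by
  funext y
  have : (fun z => g z b c) = fun z => g z c b := funext fun z => hg.symm z b c
  simp only [christoffel]
  congr 1
  refine Finset.sum_congr rfl fun d _ => ?_
  have h2 : pd d (fun z => g z b c) y = pd d (fun z => g z c b) y := by rw [this]
  rw [h2]
  ring

theorem mul_inv (hg : IsMetricOn g U) (hy : y ∈ U) : g y * (g y)⁻¹ = 1 :=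
  Matrix.mul_nonsing_inv _ (isUnit_iff_ne_zero.2 (hg.det_ne_zero y hy))

theorem inv_mul (hg : IsMetricOn g U) (hy : y ∈ U) : (g y)⁻¹ * g y = 1 :=
  Matrix.nonsing_inv_mul _ (isUnit_iff_ne_zero.2 (hg.det_ne_zero y hy))

/-- The Christoffel symbols of the first kind. -/
theorem lower_christoffel (hg : IsMetricOn g U) (hy : y ∈ U) (a b c : Fin n) :
    ∑ e, g y a e * christoffel g e b c y
      = (1 / 2) * (pd b (fun z => g z a c) y + pd c (fun z => g z a b) y
          - pd a (fun z => g z b c) y) := by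
  set X : Fin n → ℝ := fun d =>
    pd b (fun z => g z d c) y + pd c (fun z => g z d b) y - pd d (fun z => g z b c) y with hX
  have h1 : ∀ e, christoffel g e b c y = (1 / 2) * (Matrix.mulVec (g y)⁻¹ X) e := fun e => rfl
  have h2 : Matrix.mulVec (g y) (Matrix.mulVec (g y)⁻¹ X) = X := by
    rw [Matrix.mulVec_mulVec, hg.mul_inv hy, Matrix.one_mulVec]
  have h3 := congrFun h2 a
  simp only [Matrix.mulVec, dotProduct] at h3 h1
  simp only [h1]
  change _ = 1 / 2 * X a
  rw [← h3, Finset.mul_sum]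
  exact Finset.sum_congr rfl fun e _ => by ring

/-- Metric compatibility of the Levi-Civita connection. -/
theorem pd_metric (hg : IsMetricOn g U) (hy : y ∈ U) (a b c : Fin n) :
    pd c (fun z => g z a b) y
      = ∑ e, g y a e * christoffel g e c b y + ∑ e, g y b e * christoffel g e c a y := by
  rw [hg.lower_christoffel hy, hg.lower_christoffel hy]
  have h : ∀ a b, (fun z => g z a b) = fun z => g z b a := fun a b => funext fun z => hg.symm z a b
  rw [h b a, h c a, h c b]
  ring

/-! ### Algebraic symmetries of the curvature -/

theorem riemannUp_antisymm (a b c d : Fin n) : riemannUp g a b c d y = - riemannUp g a b d c y := by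
  simp only [riemannUp, Finset.sum_sub_distrib]
  ring

/-- The first Bianchi identity; it uses only the vanishing of torsion, i.e. the symmetry of Γ in its
lower indices. -/
theorem riemannUp_cyclic (hg : IsMetricOn g U) (a b c d : Fin n) :
    riemannUp g a b c d y + riemannUp g a c d b y + riemannUp g a d b c y = 0 := by
  simp only [riemannUp, Finset.sum_sub_distrib]
  rw [hg.christoffel_symm a d b, hg.christoffel_symm a c b, hg.christoffel_symm a d c]
  have h : ∀ b c e, christoffel g e b c y = christoffel g e c b y :=
    fun b c e => by rw [hg.christoffel_symm]
  simp only [h d b, h c b, h d c]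
  ring

theorem riemann_antisymm_right (y : Coord n) (a b c d : Fin n) :
    riemann g y ![a, b, c, d] = - riemann g y ![a, b, d, c] := by
  simp only [riemann, ← Finset.sum_neg_distrib]
  refine Finset.sum_congr rfl fun e _ => ?_
  simp [riemannUp_antisymm (g := g) e b c d]

theorem riemann_cyclic (hg : IsMetricOn g U) (y : Coord n) (a b c d : Fin n) :
    riemann g y ![a, b, c, d] + riemann g y ![a, c, d, b] + riemann g y ![a, d, b, c] = 0 := by
  simp only [riemann, ← Finset.sum_add_distrib]
  refine Finset.sum_eq_zero fun e _ => ?_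
  have := hg.riemannUp_cyclic (y := y) e b c d
  simp only [Matrix.cons_val_zero, Matrix.cons_val_one, Matrix.cons_val]
  linear_combination g y a e * this

/-- `R_{abcd}` in terms of the Christoffel symbols of the first kind. -/
theorem riemann_eq (hg : IsMetricOn g U) (hy : y ∈ U) (a b c d : Fin n) :
    riemann g y ![a, b, c, d]
      = pd c (fun z => ∑ e, g z a e * christoffel g e d b z) y
        - pd d (fun z => ∑ e, g z a e * christoffel g e c b z) y
        - ∑ e, ∑ f, g y e f * christoffel g f c a y * christoffel g e d b y
        + ∑ e, ∑ f, g y e f * christoffel g f d a y * christoffel g e c b y := by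
  -- Metric compatibility splits ∂g into two sums: one completes ∂Γ to ∂Γ + ΓΓ, the other is the
  -- remaining quadratic term.
  have key : ∀ c d, pd c (fun z => ∑ e, g z a e * christoffel g e d b z) y
      = ∑ e, g y a e * (pd c (christoffel g e d b) y
          + ∑ f, christoffel g e c f y * christoffel g f d b y)
        + ∑ e, ∑ f, g y e f * christoffel g f c a y * christoffel g e d b y := by
    intro c d
    rw [pd_sum _ hg.isOpen (fun e _ => (hg.smooth _ _).mul (hg.smooth_christoffel _ _ _)) hy]
    simp only [mul_add, Finset.sum_add_distrib, Finset.mul_sum]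
    rw [Finset.sum_comm (f := fun e f =>
      g y a e * (christoffel g e c f y * christoffel g f d b y))]
    rw [← Finset.sum_add_distrib, ← Finset.sum_add_distrib]
    refine Finset.sum_congr rfl fun e _ => ?_
    rw [pd_mul hg.isOpen (hg.smooth _ _) (hg.smooth_christoffel _ _ _) hy, hg.pd_metric hy,
      add_mul, Finset.sum_mul, Finset.sum_mul]
    have : ∀ f, g y a f * christoffel g f c e y * christoffel g e d b y
      = g y a f * (christoffel g f c e y * christoffel g e d b y) := fun f => by ring
    simp only [this]
    ring
  rw [key c d, key d c]
  simp only [riemann, riemannUp, Matrix.cons_val_zero, Matrix.cons_val_one, Matrix.cons_val,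
    mul_add, mul_sub, Finset.sum_add_distrib, Finset.sum_sub_distrib]
  ring

/-- The part symmetric in a, b vanishes: the first-kind symbols symmetrised in a, b give ∂_d g_{ab},
whose second partial derivatives commute, and the quadratic terms cancel by the symmetry of g. -/
theorem riemann_antisymm_left (hg : IsMetricOn g U) (hy : y ∈ U) (a b c d : Fin n) :
    riemann g y ![a, b, c, d] = - riemann g y ![b, a, c, d] := by
  have hsm : ∀ a b c, ContDiffOn ℝ ∞ (fun z => ∑ e, g z a e * christoffel g e b c z) U :=
    fun a b c => ContDiffOn.sum fun e _ => (hg.smooth _ _).mul (hg.smooth_christoffel _ _ _)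
  have h1 : ∀ c d, pd c (fun z => ∑ e, g z a e * christoffel g e d b z) y
      + pd c (fun z => ∑ e, g z b e * christoffel g e d a z) y
      = pd c (pd d (fun z => g z a b)) y := by
    intro c d
    rw [← pd_add hg.isOpen (hsm _ _ _) (hsm _ _ _) hy]
    exact pd_congr hg.isOpen (fun z hz => (hg.pd_metric hz a b d).symm) hy c
  have h2 : ∀ a b c d, ∑ e, ∑ f, g y e f * christoffel g f c a y * christoffel g e d b y
      = ∑ e, ∑ f, g y e f * christoffel g f d b y * christoffel g e c a y := by
    intro a b c d
    rw [Finset.sum_comm]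
    refine Finset.sum_congr rfl fun e _ => Finset.sum_congr rfl fun f _ => ?_
    rw [hg.symm y f e]
    ring
  rw [hg.riemann_eq hy, hg.riemann_eq hy]
  have h3 := h1 c d
  have h4 := h1 d c
  have h5 := pd_comm hg.isOpen (hg.smooth a b) hy c d
  have h6 := h2 a b c d
  have h7 := h2 a b d c
  linarith

/-- The classical octahedron argument: a linear combination of four cyclic identities and the two
antisymmetries. -/
theorem riemann_pair_symm (hg : IsMetricOn g U) (hy : y ∈ U) (a b c d : Fin n) :
    riemann g y ![a, b, c, d] = riemann g y ![c, d, a, b] := by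
  have hr := riemann_antisymm_right (g := g) y
  have hl := hg.riemann_antisymm_left hy
  have hc := hg.riemann_cyclic y
  linarith [hc a b c d, hc b c d a, hc c d a b, hc d a b c, hr a b c d, hr a c d b, hr a d b c,
    hr b c d a, hr b d a c, hr b a c d, hr c d a b, hr c a b d, hr c b d a, hr d a b c, hr d b c a,
    hr d c a b, hl a b c d, hl a c d b, hl a d b c, hl b c d a, hl b d a c, hl b a c d,
    hl c d a b, hl c a b d, hl c b d a, hl d a b c, hl d b c a, hl d c a b,
    hl a c b d, hl a d c b, hl b c a d, hl b d c a, hl c d b a, hl a b d c]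

end IsMetricOn

/-! ### Parallel vector fields -/

/-- `X` is a parallel vector field on `U`. -/
structure IsParallelOn {n : ℕ} (g : MetricField n) (X : Coord n → Fin n → ℝ) (U : Set (Coord n)) :
    Prop where
  smooth : ∀ a, ContDiffOn ℝ ∞ (fun y => X y a) U
  parallel : ∀ y ∈ U, ∀ a b, pd b (fun z => X z a) y + ∑ c, christoffel g a b c y * X y c = 0

namespace IsParallelOn

variable {n : ℕ} {g : MetricField n} {X : Coord n → Fin n → ℝ} {U : Set (Coord n)} {y : Coord n}

/-- The integrability condition of ∂_d X^a = -Γ^a_{db} X^b: differentiate it again and equate the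
mixed partial derivatives. -/
theorem riemannUp_contract (hg : IsMetricOn g U) (hX : IsParallelOn g X U) (hy : y ∈ U)
    (a c d : Fin n) : ∑ b, riemannUp g a b c d y * X y b = 0 := by
  have h1 : ∀ c d, pd c (pd d (fun z => X z a)) y
      = - ∑ b, pd c (christoffel g a d b) y * X y b
        + ∑ b, (∑ e, christoffel g a d e y * christoffel g e c b y) * X y b := by
    intro c d
    have : ∀ z ∈ U, pd d (fun z => X z a) z = - ∑ b, christoffel g a d b z * X z b :=
      fun z hz => by linarith [hX.parallel z hz a d]
    rw [pd_congr hg.isOpen this hy, pd_neg,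
      pd_sum _ hg.isOpen (fun e _ => (hg.smooth_christoffel _ _ _).mul (hX.smooth _)) hy,
      ← sub_eq_zero]
    have h2 : ∀ b, pd c (fun z => christoffel g a d b z * X z b) y
        = pd c (christoffel g a d b) y * X y b
          - ∑ e, christoffel g a d b y * christoffel g b c e y * X y e := by
      intro b
      have h3 : pd c (fun z => X z b) y = - ∑ e, christoffel g b c e y * X y e := by
        linarith [hX.parallel y hy b c]
      rw [pd_mul hg.isOpen (hg.smooth_christoffel _ _ _) (hX.smooth _) hy, h3, mul_neg,
        Finset.mul_sum, sub_eq_add_neg]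
      congr 2
      exact Finset.sum_congr rfl fun e _ => by ring
    simp only [h2, Finset.sum_sub_distrib, Finset.sum_mul]
    rw [Finset.sum_comm (f := fun b e => christoffel g a d b y * christoffel g b c e y * X y e)]
    ring
  have h4 := pd_comm hg.isOpen (hX.smooth a) hy c d
  rw [h1 c d, h1 d c] at h4
  simp only [riemannUp, add_mul, sub_mul, Finset.sum_add_distrib, Finset.sum_sub_distrib]
  linarith

theorem riemann_contract (hg : IsMetricOn g U) (hX : IsParallelOn g X U) (hy : y ∈ U)
    (a c d : Fin n) : ∑ b, riemann g y ![a, b, c, d] * X y b = 0 := by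
  simp only [riemann, Finset.sum_mul]
  rw [Finset.sum_comm]
  refine Finset.sum_eq_zero fun e _ => ?_
  have := hX.riemannUp_contract hg hy e c d
  simp only [Matrix.cons_val_zero, Matrix.cons_val_one, Matrix.cons_val]
  calc _ = g y a e * ∑ b, riemannUp g e b c d y * X y b := by
        rw [Finset.mul_sum]; exact Finset.sum_congr rfl fun b _ => by ring
    _ = 0 := by rw [this, mul_zero]

end IsParallelOn

/-! ## The second Bianchi identity -/

namespace IsMetricOn

variable {n : ℕ} {g : MetricField n} {U : Set (Coord n)} {y : Coord n}

/-- The second Bianchi identity for the curvature of the connection form `Γ_c = (Γ^a_{cb})`. -/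
theorem riemannUp_bianchi (hg : IsMetricOn g U) (hy : y ∈ U) (a b c d e : Fin n) :
    (pd e (riemannUp g a b c d) y + ∑ h, (christoffel g a e h y * riemannUp g h b c d y
        - riemannUp g a h c d y * christoffel g h e b y))
      + (pd c (riemannUp g a b d e) y + ∑ h, (christoffel g a c h y * riemannUp g h b d e y
        - riemannUp g a h d e y * christoffel g h c b y))
      + (pd d (riemannUp g a b e c) y + ∑ h, (christoffel g a d h y * riemannUp g h b e c y
        - riemannUp g a h e c y * christoffel g h d b y)) = 0 := by
  -- With a, b as matrix indices the curvature is dΓ + Γ ∧ Γ. Once mixed partial derivatives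
  -- commute, the identity is one between noncommutative polynomials.
  let Γ : Fin n → Matrix (Fin n) (Fin n) ℝ := fun c => Matrix.of fun a b => christoffel g a c b y
  let D : Fin n → Fin n → Matrix (Fin n) (Fin n) ℝ :=
    fun e c => Matrix.of fun a b => pd e (christoffel g a c b) y
  let DD : Fin n → Fin n → Fin n → Matrix (Fin n) (Fin n) ℝ :=
    fun e c d => Matrix.of fun a b => pd e (pd c (christoffel g a d b)) y
  have hDD : ∀ e c d, DD e c d = DD c e d := fun e c d => by
    ext a b
    exact pd_comm hg.isOpen (hg.smooth_christoffel _ _ _) hy e c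
  have hR : ∀ c d, (Matrix.of fun a b => riemannUp g a b c d y)
      = D c d - D d c + (Γ c * Γ d - Γ d * Γ c) := by
    intro c d
    ext a b
    simp [riemannUp, D, Γ, Matrix.mul_apply]
  have hDR : ∀ e c d, (Matrix.of fun a b => pd e (riemannUp g a b c d) y)
      = DD e c d - DD e d c
        + (D e c * Γ d + Γ c * D e d - (D e d * Γ c + Γ d * D e c)) := by
    intro e c d
    ext a b
    have h1 : ∀ a b c, ContDiffOn ℝ ∞ (christoffel g a b c) U := hg.smooth_christoffel
    have h2 : ∀ a b c i, ContDiffOn ℝ ∞ (pd i (christoffel g a b c)) U :=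
      fun a b c i => smoothOn_pd hg.isOpen (h1 a b c) i
    have h3 : pd e (riemannUp g a b c d) y
        = pd e (pd c (christoffel g a d b)) y - pd e (pd d (christoffel g a c b)) y
          + ∑ h, ((pd e (christoffel g a c h) y * christoffel g h d b y
            + christoffel g a c h y * pd e (christoffel g h d b) y)
            - (pd e (christoffel g a d h) y * christoffel g h c b y
            + christoffel g a d h y * pd e (christoffel g h c b) y)) := by
      unfold riemannUp
      rw [pd_add hg.isOpen ((h2 _ _ _ _).sub (h2 _ _ _ _))
        (ContDiffOn.sum fun h _ => ((h1 _ _ _).mul (h1 _ _ _)).sub ((h1 _ _ _).mul (h1 _ _ _))) hy,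
        pd_sub hg.isOpen (h2 _ _ _ _) (h2 _ _ _ _) hy,
        pd_sum _ hg.isOpen
          (fun h _ => ((h1 _ _ _).mul (h1 _ _ _)).sub ((h1 _ _ _).mul (h1 _ _ _))) hy]
      congr 1
      refine Finset.sum_congr rfl fun h _ => ?_
      rw [pd_sub hg.isOpen ((h1 _ _ _).mul (h1 _ _ _)) ((h1 _ _ _).mul (h1 _ _ _)) hy,
        pd_mul hg.isOpen (h1 _ _ _) (h1 _ _ _) hy, pd_mul hg.isOpen (h1 _ _ _) (h1 _ _ _) hy]
    simp only [Matrix.of_apply, h3, D, DD, Γ, Matrix.sub_apply, Matrix.add_apply, Matrix.mul_apply,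
      Finset.sum_add_distrib, Finset.sum_sub_distrib]
  have key : ∀ e c d, (Matrix.of fun a b => pd e (riemannUp g a b c d) y
        + ∑ h, (christoffel g a e h y * riemannUp g h b c d y
        - riemannUp g a h c d y * christoffel g h e b y))
      = (Matrix.of fun a b => pd e (riemannUp g a b c d) y)
        + (Γ e * (Matrix.of fun a b => riemannUp g a b c d y)
          - (Matrix.of fun a b => riemannUp g a b c d y) * Γ e) := by
    intro e c d
    ext a b
    simp [Matrix.mul_apply, Γ]
  have h : (Matrix.of fun a b => pd e (riemannUp g a b c d) y
        + ∑ h, (christoffel g a e h y * riemannUp g h b c d y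
        - riemannUp g a h c d y * christoffel g h e b y))
      + (Matrix.of fun a b => pd c (riemannUp g a b d e) y
        + ∑ h, (christoffel g a c h y * riemannUp g h b d e y
        - riemannUp g a h d e y * christoffel g h c b y))
      + (Matrix.of fun a b => pd d (riemannUp g a b e c) y
        + ∑ h, (christoffel g a d h y * riemannUp g h b e c y
        - riemannUp g a h e c y * christoffel g h d b y)) = 0 := by
    rw [key, key, key]
    simp only [hR, hDR]
    rw [hDD c d e, hDD d e c, hDD c e d]
    noncomm_ring
  exact congrFun (congrFun h a) b

/-- Lowering an index commutes with ∇: the derivative of g is absorbed by the Christoffel correction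
of the first slot. The inner bracket is the expression summed cyclically in `riemannUp_bianchi`. -/
theorem covDeriv_riemann (hg : IsMetricOn g U) (hy : y ∈ U) (a b c d e : Fin n) :
    covDeriv g (riemann g) y ![a, b, c, d, e]
      = ∑ f, g y a f * ((pd e (riemannUp g f b c d) y
          + ∑ h, (christoffel g f e h y * riemannUp g h b c d y
            - riemannUp g f h c d y * christoffel g h e b y))
          - ∑ h, christoffel g h e c y * riemannUp g f b h d y
          - ∑ h, christoffel g h e d y * riemannUp g f b c h y) := by
  have h0 : (Fin.init (α := fun _ => Fin n) ![a, b, c, d, e] : Fin 4 → Fin n) = ![a, b, c, d] := by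
    funext i; fin_cases i <;> rfl
  have u0 : ∀ x, Function.update ![a, b, c, d] 0 x = ![x, b, c, d] := fun x => by
    funext i; fin_cases i <;> rfl
  have u1 : ∀ x, Function.update ![a, b, c, d] 1 x = ![a, x, c, d] := fun x => by
    funext i; fin_cases i <;> rfl
  have u2 : ∀ x, Function.update ![a, b, c, d] 2 x = ![a, b, x, d] := fun x => by
    funext i; fin_cases i <;> rfl
  have u3 : ∀ x, Function.update ![a, b, c, d] 3 x = ![a, b, c, x] := fun x => by
    funext i; fin_cases i <;> rfl
  have hlast : (![a, b, c, d, e] : Fin 5 → Fin n) (Fin.last 4) = e := rfl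
  have c0 : (![a, b, c, d, e] : Fin 5 → Fin n) (Fin.castSucc 0) = a := rfl
  have c1 : (![a, b, c, d, e] : Fin 5 → Fin n) (Fin.castSucc 1) = b := rfl
  have c2 : (![a, b, c, d, e] : Fin 5 → Fin n) (Fin.castSucc 2) = c := rfl
  have c3 : (![a, b, c, d, e] : Fin 5 → Fin n) (Fin.castSucc 3) = d := rfl
  unfold covDeriv
  rw [Fin.sum_univ_four, h0]
  simp only [hlast, c0, c1, c2, c3, u0, u1, u2, u3]
  have hr : ∀ z a b c d, riemann g z ![a, b, c, d] = ∑ f, g z a f * riemannUp g f b c d z :=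
    fun _ _ _ _ _ => rfl
  have h1 : pd e (fun z => riemann g z ![a, b, c, d]) y
      = ∑ f, g y a f * (pd e (riemannUp g f b c d) y
          + ∑ h, christoffel g f e h y * riemannUp g h b c d y)
        + ∑ h, christoffel g h e a y * riemann g y ![h, b, c, d] := by
    simp only [hr]
    rw [pd_sum _ hg.isOpen (fun f _ => (hg.smooth _ _).mul (hg.smooth_riemannUp _ _ _ _)) hy]
    simp only [mul_add, Finset.sum_add_distrib, Finset.mul_sum]
    rw [Finset.sum_comm (f := fun f h =>
      g y a f * (christoffel g f e h y * riemannUp g h b c d y)),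
      Finset.sum_comm (f := fun h f => christoffel g h e a y * (g y h f * riemannUp g f b c d y)),
      ← Finset.sum_add_distrib, ← Finset.sum_add_distrib]
    refine Finset.sum_congr rfl fun f _ => ?_
    rw [pd_mul hg.isOpen (hg.smooth _ _) (hg.smooth_riemannUp _ _ _ _) hy, hg.pd_metric hy,
      add_mul, Finset.sum_mul, Finset.sum_mul]
    have h2 : ∀ h, g y a h * christoffel g h e f y * riemannUp g f b c d y
      = g y a h * (christoffel g h e f y * riemannUp g f b c d y) := fun _ => by ring
    have h3 : ∀ h, g y f h * christoffel g h e a y * riemannUp g f b c d y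
      = christoffel g h e a y * (g y h f * riemannUp g f b c d y) :=
      fun h => by rw [hg.symm y f h]; ring
    simp only [h2, h3]
    ring
  rw [h1]
  simp only [hr, mul_add, mul_sub, Finset.sum_add_distrib, Finset.sum_sub_distrib, Finset.mul_sum]
  rw [Finset.sum_comm (f := fun h f => christoffel g h e b y * (g y a f * riemannUp g f h c d y)),
    Finset.sum_comm (f := fun h f => christoffel g h e c y * (g y a f * riemannUp g f b h d y)),
    Finset.sum_comm (f := fun h f => christoffel g h e d y * (g y a f * riemannUp g f b c h y))]
  have e1 : ∀ f h, christoffel g h e b y * (g y a f * riemannUp g f h c d y)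
    = g y a f * (riemannUp g f h c d y * christoffel g h e b y) := fun _ _ => by ring
  have e2 : ∀ f h, christoffel g h e c y * (g y a f * riemannUp g f b h d y)
    = g y a f * (christoffel g h e c y * riemannUp g f b h d y) := fun _ _ => by ring
  have e3 : ∀ f h, christoffel g h e d y * (g y a f * riemannUp g f b c h y)
    = g y a f * (christoffel g h e d y * riemannUp g f b c h y) := fun _ _ => by ring
  simp only [e1, e2, e3]
  ring

/-- The second Bianchi identity. -/
theorem covDeriv_riemann_bianchi (hg : IsMetricOn g U) (hy : y ∈ U) (a b c d e : Fin n) :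
    covDeriv g (riemann g) y ![a, b, c, d, e] + covDeriv g (riemann g) y ![a, b, d, e, c]
      + covDeriv g (riemann g) y ![a, b, e, c, d] = 0 := by
  rw [hg.covDeriv_riemann hy, hg.covDeriv_riemann hy, hg.covDeriv_riemann hy,
    ← Finset.sum_add_distrib, ← Finset.sum_add_distrib]
  refine Finset.sum_eq_zero fun f _ => ?_
  have h1 := hg.riemannUp_bianchi hy f b c d e
  -- Γ is symmetric and R antisymmetric in the indices concerned, so the corrections of the last two
  -- curvature slots cancel in the cyclic sum.
  have h2 : ∀ c d e, ∑ h, christoffel g h e c y * riemannUp g f b h d y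
      = - ∑ h, christoffel g h c e y * riemannUp g f b d h y := by
    intro c d e
    rw [← Finset.sum_neg_distrib]
    refine Finset.sum_congr rfl fun h _ => ?_
    rw [riemannUp_antisymm f b h d, hg.christoffel_symm h e c]
    ring
  have h3 := h2 c d e
  have h4 := h2 d e c
  have h5 := h2 e c d
  linear_combination g y a f * (h1 - h3 - h4 - h5)

end IsMetricOn

/-! ## Tensors as multilinear maps and the Leibniz rule -/

section Eval

variable {n k : ℕ}

/-- The value `T(V₁, …, V_k)` of a covariant tensor. -/
def ev (T : Tensor n k) : MultilinearMap ℝ (fun _ : Fin k => Fin n → ℝ) ℝ :=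
  ∑ s : Fin k → Fin n, T s •
    (MultilinearMap.mkPiAlgebra ℝ (Fin k) ℝ).compLinearMap fun r => LinearMap.proj (s r)

theorem ev_apply (T : Tensor n k) (V : Fin k → Fin n → ℝ) :
    ev T V = ∑ s : Fin k → Fin n, T s * ∏ r, V r (s r) := by
  simp [ev]

theorem ev_single (T : Tensor n k) (s : Fin k → Fin n) :
    ev T (fun r => Pi.single (s r) 1) = T s := by
  rw [ev_apply, Finset.sum_eq_single s]
  · simp
  · intro t _ hts
    obtain ⟨r, hr⟩ := Function.ne_iff.1 hts
    rw [Finset.prod_eq_zero (Finset.mem_univ r), mul_zero]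
    simp [hr]
  · simp

theorem ev_zero (V : Fin k → Fin n → ℝ) : ev (0 : Tensor n k) V = 0 := by
  simp [ev_apply]

theorem sum_snoc {β : Type*} [AddCommMonoid β] (f : (Fin (k + 1) → Fin n) → β) :
    ∑ s, f s = ∑ b, ∑ s : Fin k → Fin n, f (Fin.snoc s b) := by
  rw [← Fintype.sum_prod_type']
  exact (Fintype.sum_equiv (Fin.snocEquiv fun _ => Fin n) _ _ fun x => rfl).symm

/-- Splits off the last slot, which for a covariant derivative is the differentiation index. -/
theorem ev_succ (T : Tensor n (k + 1)) (W : Fin (k + 1) → Fin n → ℝ) :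
    ev T W = ∑ b, W (Fin.last k) b * ev (fun s => T (Fin.snoc s b)) (Fin.init W) := by
  rw [ev_apply, sum_snoc]
  refine Finset.sum_congr rfl fun b _ => ?_
  rw [ev_apply, Finset.mul_sum]
  refine Finset.sum_congr rfl fun s _ => ?_
  rw [Fin.prod_univ_castSucc]
  simp only [Fin.snoc_castSucc, Fin.snoc_last, Fin.init]
  ring

/-- Exchanging the new and the old value at the slot `r`. -/
theorem sum_update_comm {β : Type*} [AddCommMonoid β] (r : Fin k)
    (F : (Fin k → Fin n) → Fin n → β) :
    ∑ s, ∑ d, F s d = ∑ s, ∑ d, F (Function.update s r d) (s r) := by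
  rw [← Fintype.sum_prod_type', ← Fintype.sum_prod_type']
  refine Finset.sum_nbij' (fun p => (Function.update p.1 r p.2, p.1 r))
    (fun p => (Function.update p.1 r p.2, p.1 r)) ?_ ?_ ?_ ?_ ?_ <;> simp

end Eval

/-- The covariant derivative `∂_b V^a + Γ^a_{bc} V^c` of a vector field. -/
noncomputable def covVec {n : ℕ} (g : MetricField n) (b : Fin n) (V : Coord n → Fin n → ℝ) (y : Coord n) :
    Fin n → ℝ :=
  fun a => pd b (fun z => V z a) y + ∑ c, christoffel g a b c y * V y c

theorem covDeriv_snoc {n k : ℕ} (g : MetricField n) (T : Field n k) (y : Coord n)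
    (s : Fin k → Fin n) (b : Fin n) :
    covDeriv g T y (Fin.snoc s b) = pd b (fun z => T z s) y
      - ∑ r, ∑ d, christoffel g d b (s r) y * T y (Function.update s r d) := by
  simp [covDeriv]

theorem IsParallelOn.covVec_eq_zero {n : ℕ} {g : MetricField n} {X : Coord n → Fin n → ℝ}
    {U : Set (Coord n)} {y : Coord n} (hX : IsParallelOn g X U) (hy : y ∈ U) (b : Fin n) :
    covVec g b X y = 0 :=
  funext fun a => hX.parallel y hy a b

namespace IsMetricOn

variable {n k : ℕ} {g : MetricField n} {U : Set (Coord n)} {y : Coord n}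

/-- The Leibniz rule for the evaluation of a tensor field on vector fields. -/
theorem pd_ev (hg : IsMetricOn g U) (hy : y ∈ U) {T : Field n k}
    (hT : ∀ s, ContDiffOn ℝ ∞ (fun y => T y s) U) {V : Coord n → Fin k → Fin n → ℝ}
    (hV : ∀ r a, ContDiffOn ℝ ∞ (fun y => V y r a) U) (b : Fin n) :
    pd b (fun z => ev (T z) (V z)) y
      = ev (fun s => covDeriv g T y (Fin.snoc s b)) (V y)
        + ∑ r, ev (T y) (Function.update (V y) r (covVec g b (fun z => V z r) y)) := by
  have hprod : ∀ s : Fin k → Fin n, ContDiffOn ℝ ∞ (fun z => ∏ r, V z r (s r)) U :=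
    fun s => contDiffOn_prod fun r _ => hV r _
  have hupd : ∀ (s : Fin k → Fin n) (r : Fin k) (v : Fin n → ℝ),
      ∏ r', Function.update (V y) r v r' (s r')
        = (∏ r' ∈ Finset.univ.erase r, V y r' (s r')) * v (s r) := by
    intro s r v
    rw [← Finset.mul_prod_erase _ _ (Finset.mem_univ r), mul_comm]
    congr 1
    · refine Finset.prod_congr rfl fun r' hr' => ?_
      rw [Function.update_of_ne (Finset.ne_of_mem_erase hr')]
    · simp
  have h1 : pd b (fun z => ev (T z) (V z)) y
      = ∑ s, (pd b (fun z => T z s) y * ∏ r, V y r (s r)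
        + T y s * ∑ r, (∏ r' ∈ Finset.univ.erase r, V y r' (s r')) *
            pd b (fun z => V z r (s r)) y) := by
    simp only [ev_apply]
    rw [pd_sum _ hg.isOpen (fun s _ => (hT s).mul (hprod s)) hy]
    refine Finset.sum_congr rfl fun s _ => ?_
    rw [pd_mul hg.isOpen (hT s) (hprod s) hy, pd_prod _ hg.isOpen (fun r _ => hV r _) hy]
  have h2 : ∀ r, ev (T y) (Function.update (V y) r (covVec g b (fun z => V z r) y))
      = ∑ s, T y s * ((∏ r' ∈ Finset.univ.erase r, V y r' (s r')) *
            pd b (fun z => V z r (s r)) y)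
        + ∑ s : Fin k → Fin n, (∑ d, christoffel g d b (s r) y * T y (Function.update s r d))
            * ∏ r', V y r' (s r') := by
    intro r
    have h3 : ∑ s : Fin k → Fin n,
        (∑ d, christoffel g d b (s r) y * T y (Function.update s r d)) * ∏ r', V y r' (s r')
        = ∑ s, T y s * ((∏ r' ∈ Finset.univ.erase r, V y r' (s r')) *
            ∑ c, christoffel g (s r) b c y * V y r c) := by
      simp only [Finset.sum_mul, Finset.mul_sum]
      -- Interchanging the summed index with the index in slot r moves the Christoffel symbol from
      -- the tensor to the vector field.
      rw [sum_update_comm r]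
      refine Finset.sum_congr rfl fun s _ => Finset.sum_congr rfl fun d _ => ?_
      rw [← Finset.mul_prod_erase _ _ (Finset.mem_univ r)]
      have : ∀ r' ∈ Finset.univ.erase r, V y r' (Function.update s r d r') = V y r' (s r') :=
        fun r' hr' => by rw [Function.update_of_ne (Finset.ne_of_mem_erase hr')]
      rw [Finset.prod_congr rfl this]
      simp
      ring
    rw [h3, ev_apply, ← Finset.sum_add_distrib]
    refine Finset.sum_congr rfl fun s _ => ?_
    rw [hupd]
    simp only [covVec]
    ring
  rw [h1, ev_apply]
  simp only [h2, covDeriv_snoc, Finset.sum_add_distrib, sub_mul, Finset.sum_sub_distrib,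
    Finset.mul_sum (s := (Finset.univ : Finset (Fin k)))]
  rw [Finset.sum_comm (f := fun r s => T y s * ((∏ r' ∈ Finset.univ.erase r, V y r' (s r')) *
            pd b (fun z => V z r (s r)) y)),
    Finset.sum_comm (f := fun r (s : Fin k → Fin n) =>
      (∑ d, christoffel g d b (s r) y * T y (Function.update s r d)) * ∏ r', V y r' (s r'))]
  simp only [Finset.sum_mul (s := (Finset.univ : Finset (Fin k)))]
  ring

/-- The Leibniz rule for the scalar product of two vector fields. -/
theorem pd_dot (hg : IsMetricOn g U) (hy : y ∈ U) {X V : Coord n → Fin n → ℝ}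
    (hX : ∀ a, ContDiffOn ℝ ∞ (fun y => X y a) U) (hV : ∀ a, ContDiffOn ℝ ∞ (fun y => V y a) U)
    (b : Fin n) :
    pd b (fun z => dot (g z) (X z) (V z)) y
      = dot (g y) (covVec g b X y) (V y) + dot (g y) (X y) (covVec g b V y) := by
  have h1 : pd b (fun z => dot (g z) (X z) (V z)) y
      = ∑ a, ∑ c, (((∑ e, g y a e * christoffel g e b c y) + ∑ e, g y c e * christoffel g e b a y)
          * X y a * V y c + g y a c * pd b (fun z => X z a) y * V y c
          + g y a c * X y a * pd b (fun z => V z c) y) := by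
    unfold dot
    rw [pd_sum _ hg.isOpen (fun a _ => ContDiffOn.sum fun c _ =>
      ((hg.smooth _ _).mul (hX _)).mul (hV _)) hy]
    refine Finset.sum_congr rfl fun a _ => ?_
    rw [pd_sum _ hg.isOpen (fun c _ => ((hg.smooth _ _).mul (hX _)).mul (hV _)) hy]
    refine Finset.sum_congr rfl fun c _ => ?_
    rw [pd_mul hg.isOpen ((hg.smooth _ _).mul (hX _)) (hV _) hy,
      pd_mul hg.isOpen (hg.smooth _ _) (hX _) hy, hg.pd_metric hy]
    ring
  rw [h1]
  simp only [dot, covVec, add_mul, mul_add, Finset.sum_add_distrib, Finset.sum_mul, Finset.mul_sum]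
  have h2 : ∑ a, ∑ c, ∑ e, g y a e * christoffel g e b c y * X y a * V y c
      = ∑ a, ∑ c, ∑ e, g y a c * X y a * (christoffel g c b e y * V y e) := by
    refine Finset.sum_congr rfl fun a _ => ?_
    rw [Finset.sum_comm]
    refine Finset.sum_congr rfl fun c _ => Finset.sum_congr rfl fun e _ => ?_
    ring
  have h3 : ∑ a, ∑ c, ∑ e, g y c e * christoffel g e b a y * X y a * V y c
      = ∑ a, ∑ c, ∑ e, g y a c * (christoffel g a b e y * X y e) * V y c := by
    rw [Finset.sum_comm]
    calc _ = ∑ c, ∑ e, ∑ a, g y c e * christoffel g e b a y * X y a * V y c :=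
          Finset.sum_congr rfl fun c _ => Finset.sum_comm
      _ = ∑ e, ∑ c, ∑ a, g y c e * christoffel g e b a y * X y a * V y c := Finset.sum_comm
      _ = _ := by
          refine Finset.sum_congr rfl fun e _ => Finset.sum_congr rfl fun c _ =>
            Finset.sum_congr rfl fun a _ => ?_
          rw [hg.symm y c e]
          ring
  rw [h2, h3]
  ring

/-- The Ricci identity. -/
theorem covDeriv_covDeriv_comm (hg : IsMetricOn g U) (hy : y ∈ U) {T : Field n k}
    (hT : ∀ s, ContDiffOn ℝ ∞ (fun y => T y s) U) (s : Fin k → Fin n) (b c : Fin n) :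
    covDeriv g (covDeriv g T) y (Fin.snoc (Fin.snoc s c) b)
        - covDeriv g (covDeriv g T) y (Fin.snoc (Fin.snoc s b) c)
      = - ∑ r, ∑ d, riemannUp g d (s r) b c y * T y (Function.update s r d) := by
  classical
  have hΓ := hg.smooth_christoffel
  -- `Q` collects the terms with two Christoffel symbols. Its part `off`, where they act on
  -- different slots, is invariant under exchanging (b, r) with (c, r') and drops out of the
  -- commutator; the part with both on one slot gives the ΓΓ terms of the curvature.
  let Q : Fin n → Fin n → ℝ := fun b c => ∑ r, ∑ d, christoffel g d b (s r) y *
    ∑ r', ∑ d', christoffel g d' c (Function.update s r d r') y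
      * T y (Function.update (Function.update s r d) r' d')
  let off : Fin n → Fin n → Fin k → Fin k → ℝ := fun b c r r' => if r' = r then 0 else
    ∑ d, ∑ d', christoffel g d b (s r) y * (christoffel g d' c (s r') y
      * T y (Function.update (Function.update s r d) r' d'))
  have h1 : ∀ b c, covDeriv g (covDeriv g T) y (Fin.snoc (Fin.snoc s c) b)
      = pd b (pd c (fun z => T z s)) y
        - ∑ r, ∑ d, pd b (christoffel g d c (s r)) y * T y (Function.update s r d)
        - ∑ r, ∑ d, christoffel g d c (s r) y * pd b (fun z => T z (Function.update s r d)) y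
        - ∑ r, ∑ d, christoffel g d b (s r) y * pd c (fun z => T z (Function.update s r d)) y
        + Q b c - ∑ d, christoffel g d b c y * covDeriv g T y (Fin.snoc s d) := by
    intro b c
    rw [covDeriv_snoc, Fin.sum_univ_castSucc]
    simp only [Fin.snoc_castSucc, Fin.snoc_last, ← Fin.snoc_update, Fin.update_snoc_last]
    have h2 : pd b (fun z => covDeriv g T z (Fin.snoc s c)) y
        = pd b (pd c (fun z => T z s)) y
        - ∑ r, ∑ d, pd b (christoffel g d c (s r)) y * T y (Function.update s r d)
        - ∑ r, ∑ d, christoffel g d c (s r) y * pd b (fun z => T z (Function.update s r d)) y := by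
      simp only [covDeriv_snoc]
      rw [pd_sub hg.isOpen (smoothOn_pd hg.isOpen (hT _) _)
        (ContDiffOn.sum fun r _ => ContDiffOn.sum fun d _ => (hΓ _ _ _).mul (hT _)) hy,
        pd_sum _ hg.isOpen (fun r _ => ContDiffOn.sum fun d _ => (hΓ _ _ _).mul (hT _)) hy,
        sub_sub, ← Finset.sum_add_distrib]
      congr 1
      refine Finset.sum_congr rfl fun r _ => ?_
      rw [pd_sum _ hg.isOpen (fun d _ => (hΓ _ _ _).mul (hT _)) hy, ← Finset.sum_add_distrib]
      exact Finset.sum_congr rfl fun d _ => pd_mul hg.isOpen (hΓ _ _ _) (hT _) hy b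
    rw [h2]
    have h3 : ∑ r, ∑ d, christoffel g d b (s r) y *
          covDeriv g T y (Fin.snoc (Function.update s r d) c)
        = ∑ r, ∑ d, christoffel g d b (s r) y * pd c (fun z => T z (Function.update s r d)) y
          - Q b c := by
      simp only [Q, covDeriv_snoc, mul_sub, Finset.sum_sub_distrib]
    rw [h3]
    ring
  have hQ : ∀ b c, Q b c = ∑ r, ∑ r', off b c r r'
      + ∑ r, ∑ d, (∑ e, christoffel g d c e y * christoffel g e b (s r) y)
          * T y (Function.update s r d) := by
    intro b c
    simp only [Q]
    rw [← Finset.sum_add_distrib]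
    refine Finset.sum_congr rfl fun r _ => ?_
    simp only [Finset.mul_sum]
    rw [Finset.sum_comm, ← Finset.add_sum_erase _ _ (Finset.mem_univ r),
      ← Finset.add_sum_erase Finset.univ (off b c r) (Finset.mem_univ r), add_comm]
    have h2 : off b c r r = 0 := by simp [off]
    rw [h2, zero_add]
    congr 1
    · refine Finset.sum_congr rfl fun r' hr' => ?_
      have hne := Finset.ne_of_mem_erase hr'
      simp [off, hne]
    · simp only [Function.update_self, Function.update_idem, Finset.sum_mul]
      rw [Finset.sum_comm]
      exact Finset.sum_congr rfl fun d _ => Finset.sum_congr rfl fun e _ => by ring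
  have hoff : ∀ b c r r', off b c r r' = off c b r' r := by
    intro b c r r'
    by_cases h : r' = r
    · simp [off, h]
    · simp only [off, h, Ne.symm h, if_false]
      rw [Finset.sum_comm]
      refine Finset.sum_congr rfl fun d _ => Finset.sum_congr rfl fun d' _ => ?_
      rw [Function.update_comm h]
      ring
  have hoff' : ∑ r, ∑ r', off b c r r' = ∑ r, ∑ r', off c b r r' := by
    rw [Finset.sum_comm]
    exact Finset.sum_congr rfl fun r _ => Finset.sum_congr rfl fun r' _ => hoff _ _ _ _
  have h4 : ∑ r, ∑ d, riemannUp g d (s r) b c y * T y (Function.update s r d)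
      = ∑ r, ∑ d, pd b (christoffel g d c (s r)) y * T y (Function.update s r d)
        - ∑ r, ∑ d, pd c (christoffel g d b (s r)) y * T y (Function.update s r d)
        + ∑ r, ∑ d, (∑ e, christoffel g d b e y * christoffel g e c (s r) y)
          * T y (Function.update s r d)
        - ∑ r, ∑ d, (∑ e, christoffel g d c e y * christoffel g e b (s r) y)
          * T y (Function.update s r d) := by
    simp only [riemannUp, add_mul, sub_mul, Finset.sum_add_distrib, Finset.sum_sub_distrib]
    ring
  have h5 := pd_comm hg.isOpen (hT s) hy b c
  -- Without torsion, the corrections for the first differentiation index agree in both orders and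
  -- cancel.
  have h6 : ∀ d, christoffel g d b c y = christoffel g d c b y :=
    fun d => by rw [hg.christoffel_symm]
  rw [h1 b c, h1 c b, hQ, hQ, h4]
  simp only [h6]
  linarith

end IsMetricOn

/-! ## Tensors annihilated by a parallel null vector -/

/-- All contractions of the tensor `T` with the vector `v` vanish. -/
def KilledBy {n k : ℕ} (v : Fin n → ℝ) (T : Tensor n k) : Prop :=
  ∀ (V : Fin k → Fin n → ℝ) (r : Fin k), V r = v → ev T V = 0

/-- `T` vanishes on the vectors orthogonal to `v`. -/
def VanishesOnPerp {n k : ℕ} (G : Matrix (Fin n) (Fin n) ℝ) (v : Fin n → ℝ) (T : Tensor n k) :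
    Prop :=
  ∀ V : Fin k → Fin n → ℝ, (∀ r, dot G v (V r) = 0) → ev T V = 0

section Dot

variable {n k : ℕ} {G : Matrix (Fin n) (Fin n) ℝ}

theorem dot_eq_dotProduct (u v : Fin n → ℝ) : dot G u v = u ⬝ᵥ (G.mulVec v) := by
  simp only [dot, dotProduct, Matrix.mulVec, Finset.mul_sum]
  exact Finset.sum_congr rfl fun a _ => Finset.sum_congr rfl fun b _ => by ring

theorem dot_sub_right (u v w : Fin n → ℝ) : dot G u (v - w) = dot G u v - dot G u w := by
  simp only [dot_eq_dotProduct, Matrix.mulVec_sub, dotProduct_sub]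

theorem dot_smul_right (c : ℝ) (u v : Fin n → ℝ) : dot G u (c • v) = c * dot G u v := by
  simp only [dot_eq_dotProduct, Matrix.mulVec_smul, dotProduct_smul, smul_eq_mul]

theorem ev_update_single (T : Tensor n k) (t : Fin k → Fin n) (r : Fin k) (v : Fin n → ℝ) :
    ev T (Function.update (fun i => Pi.single (t i) 1) r v)
      = ∑ e, v e * T (Function.update t r e) := by
  have hv : v = ∑ e, v e • (Pi.single e 1 : Fin n → ℝ) := by
    rw [← pi_eq_sum_univ' v]
  conv_lhs => rw [hv]
  rw [MultilinearMap.map_update_sum]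
  refine Finset.sum_congr rfl fun e _ => ?_
  rw [MultilinearMap.map_update_smul, smul_eq_mul, ← ev_single T]
  congr 2
  funext i
  by_cases h : i = r
  · subst h; simp
  · simp [h]

theorem sum_fin_four {β : Type*} [AddCommMonoid β] (f : (Fin 4 → Fin n) → β) :
    ∑ s, f s = ∑ a, ∑ b, ∑ c, ∑ d, f ![a, b, c, d] := by
  have hcons : ∀ (k : ℕ) (f : (Fin (k + 1) → Fin n) → β),
      ∑ s, f s = ∑ a, ∑ s : Fin k → Fin n, f (Matrix.vecCons a s) := fun k f => by
    rw [← Fintype.sum_prod_type']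
    exact (Fintype.sum_equiv (Fin.consEquiv fun _ => Fin n) _ _ fun x => rfl).symm
  simp only [hcons, Finset.univ_unique, Finset.sum_singleton,
    Subsingleton.elim (default : Fin 0 → Fin n) ![]]

theorem ev_four (T : Tensor n 4) (V : Fin 4 → Fin n → ℝ) :
    ev T V = ∑ a, ∑ b, ∑ c, ∑ d, T ![a, b, c, d] * (V 0 a * V 1 b * V 2 c * V 3 d) := by
  rw [ev_apply, sum_fin_four]
  simp [Fin.prod_univ_four]

end Dot

/-- Nondegeneracy provides a vector transversal to v^⊥. The witness raises the index of a covector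
supported on a coordinate where v is nonzero. -/
theorem IsMetricOn.exists_dot_eq_one {n : ℕ} {g : MetricField n} {U : Set (Coord n)}
    {y : Coord n} (hg : IsMetricOn g U) (hy : y ∈ U) {v : Fin n → ℝ} (hv : v ≠ 0) :
    ∃ N, dot (g y) v N = 1 := by
  obtain ⟨a, ha⟩ := Function.ne_iff.1 hv
  refine ⟨(g y)⁻¹.mulVec (Pi.single a (v a)⁻¹), ?_⟩
  rw [dot_eq_dotProduct, Matrix.mulVec_mulVec, hg.mul_inv hy, Matrix.one_mulVec,
    dotProduct_single]
  exact mul_inv_cancel₀ ha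

/-- Pair symmetry is available only for the lowered tensor, so the contraction is shown to vanish
after lowering, and g is then inverted. This is the slot in which the Ricci identity needs the
field. -/
theorem IsParallelOn.riemannUp_contract_third {n : ℕ} {g : MetricField n}
    {X : Coord n → Fin n → ℝ} {U : Set (Coord n)} {y : Coord n} (hX : IsParallelOn g X U)
    (hg : IsMetricOn g U) (hy : y ∈ U) (a b d : Fin n) :
    ∑ c, X y c * riemannUp g a b c d y = 0 := by
  have h1 : ∀ a b d, ∑ c, X y c * riemann g y ![a, b, c, d] = 0 := fun a b d => by
    rw [← neg_eq_zero, ← Finset.sum_neg_distrib, ← hX.riemann_contract hg hy d a b]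
    refine Finset.sum_congr rfl fun c _ => ?_
    rw [hg.riemann_pair_symm hy a b c d, hg.riemann_antisymm_left hy c d]
    ring
  let w : Fin n → ℝ := fun e => ∑ c, X y c * riemannUp g e b c d y
  have h2 : (g y).mulVec w = 0 := by
    funext a
    rw [Pi.zero_apply, ← h1 a b d]
    simp only [Matrix.mulVec, dotProduct, w, riemann, Finset.mul_sum]
    rw [Finset.sum_comm]
    refine Finset.sum_congr rfl fun c _ => Finset.sum_congr rfl fun e _ => ?_
    simp only [Matrix.cons_val_zero, Matrix.cons_val_one, Matrix.cons_val]
    ring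
  have h3 : w = 0 := by
    rw [← Matrix.one_mulVec w, ← hg.inv_mul hy, ← Matrix.mulVec_mulVec, h2, Matrix.mulVec_zero]
  exact congrFun h3 a

/-! ### Propagation of both vanishing conditions to covariant derivatives -/

section Parallel

variable {n k : ℕ} {g : MetricField n} {X : Coord n → Fin n → ℝ} {U : Set (Coord n)}
  {y : Coord n} {T : Field n k}

/-- If the contraction of `T` with a parallel field in the slot `r` vanishes, so does that of the
covariant derivative. -/
theorem ev_covDeriv_eq_zero (hg : IsMetricOn g U) (hX : IsParallelOn g X U)
    (hT : ∀ s, ContDiffOn ℝ ∞ (fun y => T y s) U) (r : Fin k)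
    (h : ∀ z ∈ U, ∀ V : Fin k → Fin n → ℝ, V r = X z → ev (T z) V = 0) (hy : y ∈ U)
    (W : Fin (k + 1) → Fin n → ℝ) (hW : W r.castSucc = X y) :
    ev (covDeriv g T y) W = 0 := by
  classical
  rw [ev_succ]
  refine Finset.sum_eq_zero fun b _ => ?_
  -- The given vectors are extended with constant components, except that slot r carries the field
  -- X. Then T(V) vanishes identically and ∇X = 0 removes the Leibniz term of slot r.
  let V : Coord n → Fin k → Fin n → ℝ := fun z => Function.update (Fin.init W) r (X z)
  have hVy : V y = Fin.init W := by
    simp only [V]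
    rw [← hW]
    exact Function.update_eq_self r (Fin.init W)
  have hV : ∀ r' a, ContDiffOn ℝ ∞ (fun z => V z r' a) U := by
    intro r' a
    by_cases hr : r' = r
    · subst hr
      simpa [V] using hX.smooth a
    · simpa [V, hr] using contDiffOn_const
  have h1 := hg.pd_ev hy hT hV b
  have h2 : pd b (fun z => ev (T z) (V z)) y = 0 := by
    rw [pd_congr hg.isOpen (h := fun _ => 0) (fun z hz => h z hz (V z) (by simp [V])) hy, pd_const]
  have h3 : ∑ r', ev (T y) (Function.update (V y) r' (covVec g b (fun z => V z r') y)) = 0 := by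
    refine Finset.sum_eq_zero fun r' _ => ?_
    by_cases hr : r' = r
    · subst hr
      have : (fun z => V z r') = X := by funext z; simp [V]
      rw [this, hX.covVec_eq_zero hy]
      exact (ev (T y)).map_coord_zero r' (by simp)
    · refine h y hy _ ?_
      rw [Function.update_of_ne (Ne.symm hr)]
      simp [V]
  rw [h2, h3, add_zero, hVy] at h1
  rw [← h1, mul_zero]

/-- The Leibniz rule settles the old slots but says nothing about the differentiation slot, which
therefore enters as the hypothesis `hlast`. -/
theorem killedBy_covDeriv (hg : IsMetricOn g U) (hX : IsParallelOn g X U)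
    (hT : ∀ s, ContDiffOn ℝ ∞ (fun y => T y s) U) (h : ∀ z ∈ U, KilledBy (X z) (T z))
    (hlast : ∀ z ∈ U, ∀ s, ∑ b, X z b * covDeriv g T z (Fin.snoc s b) = 0) (hy : y ∈ U) :
    KilledBy (X y) (covDeriv g T y) := by
  intro V r
  induction r using Fin.lastCases with
  | cast r => exact ev_covDeriv_eq_zero hg hX hT r (fun z hz V hV => h z hz V r hV) hy V
  | last =>
    intro hV
    rw [ev_succ, hV]
    simp only [ev_apply, Finset.mul_sum]
    rw [Finset.sum_comm]
    refine Finset.sum_eq_zero fun s _ => ?_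
    simp only [← mul_assoc, ← Finset.sum_mul]
    rw [hlast y hy s, zero_mul]

/-- To contract X with the outer derivative, exchange the two derivatives: X then sits in a slot of
∇T, which it annihilates, and the commutator contains the curvature contracted with X. -/
theorem killedBy_covDeriv_covDeriv (hg : IsMetricOn g U) (hX : IsParallelOn g X U)
    (hT : ∀ s, ContDiffOn ℝ ∞ (fun y => T y s) U) (h : ∀ z ∈ U, KilledBy (X z) (covDeriv g T z))
    (hy : y ∈ U) : KilledBy (X y) (covDeriv g (covDeriv g T) y) := by
  refine killedBy_covDeriv hg hX (hg.smooth_covDeriv hT) h (fun z hz s => ?_) hy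
  have h1 : ∑ b, X z b * covDeriv g (covDeriv g T) z
      (Fin.snoc (Fin.snoc (Fin.init s) b) (s (Fin.last k))) = 0 := by
    have h2 := ev_covDeriv_eq_zero hg hX (hg.smooth_covDeriv hT) (Fin.last k)
      (fun z hz V hV => h z hz V _ hV) hz
      (Fin.snoc (Fin.snoc (fun r => Pi.single (Fin.init s r) 1) (X z))
        (Pi.single (s (Fin.last k)) 1)) (by simp)
    rw [ev_succ, Finset.sum_eq_single (s (Fin.last k))] at h2
    · simp only [Fin.snoc_last, Pi.single_eq_same, one_mul, Fin.init_snoc] at h2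
      rw [ev_succ] at h2
      simp only [Fin.snoc_last, Fin.init_snoc] at h2
      rw [← h2]
      refine Finset.sum_congr rfl fun b _ => ?_
      rw [ev_single]
    · intro b _ hb
      simp [hb]
    · simp
  have h3 : ∀ b, covDeriv g (covDeriv g T) z (Fin.snoc s b)
      = covDeriv g (covDeriv g T) z (Fin.snoc (Fin.snoc (Fin.init s) b) (s (Fin.last k)))
        - ∑ r, ∑ d, riemannUp g d (Fin.init s r) b (s (Fin.last k)) z
          * T z (Function.update (Fin.init s) r d) := by
    intro b
    have := hg.covDeriv_covDeriv_comm hz hT (Fin.init s) b (s (Fin.last k))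
    rw [Fin.snoc_init_self] at this
    linarith
  simp only [h3, mul_sub, Finset.sum_sub_distrib, h1, zero_sub, neg_eq_zero, Finset.mul_sum]
  rw [Finset.sum_comm]
  refine Finset.sum_eq_zero fun r _ => ?_
  rw [Finset.sum_comm]
  refine Finset.sum_eq_zero fun d _ => ?_
  simp only [← mul_assoc, ← Finset.sum_mul]
  rw [hX.riemannUp_contract_third hg hz, zero_mul]

/-- Since X is parallel, the covariant derivative of a field orthogonal to X stays orthogonal to X.
For such fields every term of the Leibniz rule other than ∇T vanishes. -/
theorem vanishesOnPerp_covDeriv (hg : IsMetricOn g U) (hX : IsParallelOn g X U)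
    (hX0 : ∀ y ∈ U, X y ≠ 0) (hT : ∀ s, ContDiffOn ℝ ∞ (fun y => T y s) U)
    (h : ∀ z ∈ U, VanishesOnPerp (g z) (X z) (T z)) (hy : y ∈ U) :
    VanishesOnPerp (g y) (X y) (covDeriv g T y) := by
  intro W hW
  obtain ⟨N, hN⟩ := hg.exists_dot_eq_one hy (hX0 y hy)
  rw [ev_succ]
  refine Finset.sum_eq_zero fun b _ => ?_
  -- The combination (X·N) W - (X·W) N is orthogonal to X at every point, and at y it reduces to W
  -- because X·N = 1 and X·W = 0 there.
  let V : Coord n → Fin k → Fin n → ℝ := fun z r =>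
    dot (g z) (X z) N • W r.castSucc - dot (g z) (X z) (W r.castSucc) • N
  have hdot : ∀ v : Fin n → ℝ, ContDiffOn ℝ ∞ (fun z => dot (g z) (X z) v) U := fun v =>
    ContDiffOn.sum fun a _ => ContDiffOn.sum fun c _ =>
      ((hg.smooth _ _).mul (hX.smooth _)).mul contDiffOn_const
  have hV : ∀ r a, ContDiffOn ℝ ∞ (fun z => V z r a) U := fun r a =>
    ((hdot N).mul contDiffOn_const).sub ((hdot _).mul contDiffOn_const)
  have hVperp : ∀ z r, dot (g z) (X z) (V z r) = 0 := by
    intro z r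
    simp only [V, dot_sub_right, dot_smul_right]
    ring
  have hVy : V y = Fin.init W := by
    funext r
    simp [V, hN, hW, Fin.init]
  have h1 := hg.pd_ev hy hT hV b
  have h2 : pd b (fun z => ev (T z) (V z)) y = 0 := by
    rw [pd_congr hg.isOpen (h := fun _ => 0) (fun z hz => h z hz (V z) (hVperp z)) hy, pd_const]
  have h3 : ∑ r', ev (T y) (Function.update (V y) r' (covVec g b (fun z => V z r') y)) = 0 := by
    refine Finset.sum_eq_zero fun r' _ => h y hy _ fun r => ?_
    by_cases hr : r = r'
    · subst hr
      rw [Function.update_self]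
      have h4 := hg.pd_dot hy hX.smooth (hV r) b
      rw [hX.covVec_eq_zero hy] at h4
      have h5 : pd b (fun z => dot (g z) (X z) (V z r)) y = 0 := by
        rw [pd_congr hg.isOpen (h := fun _ => 0) (fun z _ => hVperp z r) hy, pd_const]
      have h6 : dot (g y) 0 (V y r) = 0 := by simp [dot]
      linarith
    · rw [Function.update_of_ne hr]
      exact hVperp y r
  rw [h2, h3, add_zero, hVy] at h1
  rw [← h1, mul_zero]

theorem killedBy_riemann (hg : IsMetricOn g U) (hX : IsParallelOn g X U) (hy : y ∈ U) :
    KilledBy (X y) (riemann g y) := by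
  have h1 : ∀ a c d, ∑ b, X y b * riemann g y ![a, b, c, d] = 0 := fun a c d => by
    rw [← hX.riemann_contract hg hy a c d]
    exact Finset.sum_congr rfl fun b _ => mul_comm _ _
  have h0 : ∀ b c d, ∑ a, X y a * riemann g y ![a, b, c, d] = 0 := fun b c d => by
    rw [← neg_eq_zero, ← Finset.sum_neg_distrib, ← h1 b c d]
    refine Finset.sum_congr rfl fun a _ => ?_
    rw [hg.riemann_antisymm_left hy a b]
    ring
  have h3 : ∀ a b c, ∑ d, X y d * riemann g y ![a, b, c, d] = 0 := fun a b c => by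
    rw [← h1 c a b]
    exact Finset.sum_congr rfl fun d _ => by rw [hg.riemann_pair_symm hy a b c d]
  have h2 : ∀ a b d, ∑ c, X y c * riemann g y ![a, b, c, d] = 0 := fun a b d => by
    rw [← h0 d a b]
    exact Finset.sum_congr rfl fun c _ => by rw [hg.riemann_pair_symm hy a b c d]
  intro V r hV
  rw [ev_four]
  fin_cases r <;> simp only [Fin.zero_eta, Fin.mk_one, Fin.reduceFinMk] at hV <;> rw [hV]
  · rw [Finset.sum_comm]
    refine Finset.sum_eq_zero fun b _ => ?_
    rw [Finset.sum_comm]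
    refine Finset.sum_eq_zero fun c _ => ?_
    rw [Finset.sum_comm]
    refine Finset.sum_eq_zero fun d _ => ?_
    calc _ = (∑ a, X y a * riemann g y ![a, b, c, d]) * (V 1 b * V 2 c * V 3 d) := by
          rw [Finset.sum_mul]; exact Finset.sum_congr rfl fun a _ => by ring
      _ = 0 := by rw [h0, zero_mul]
  · refine Finset.sum_eq_zero fun a _ => ?_
    rw [Finset.sum_comm]
    refine Finset.sum_eq_zero fun c _ => ?_
    rw [Finset.sum_comm]
    refine Finset.sum_eq_zero fun d _ => ?_
    calc _ = (∑ b, X y b * riemann g y ![a, b, c, d]) * (V 0 a * V 2 c * V 3 d) := by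
          rw [Finset.sum_mul]; exact Finset.sum_congr rfl fun b _ => by ring
      _ = 0 := by rw [h1, zero_mul]
  · refine Finset.sum_eq_zero fun a _ => Finset.sum_eq_zero fun b _ => ?_
    rw [Finset.sum_comm]
    refine Finset.sum_eq_zero fun d _ => ?_
    calc _ = (∑ c, X y c * riemann g y ![a, b, c, d]) * (V 0 a * V 1 b * V 3 d) := by
          rw [Finset.sum_mul]; exact Finset.sum_congr rfl fun c _ => by ring
      _ = 0 := by rw [h2, zero_mul]
  · refine Finset.sum_eq_zero fun a _ => Finset.sum_eq_zero fun b _ =>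
      Finset.sum_eq_zero fun c _ => ?_
    calc _ = (∑ d, X y d * riemann g y ![a, b, c, d]) * (V 0 a * V 1 b * V 2 c) := by
          rw [Finset.sum_mul]; exact Finset.sum_congr rfl fun d _ => by ring
      _ = 0 := by rw [h3, zero_mul]

/-- The second Bianchi identity moves the differentiation index into a curvature slot, where the
Leibniz rule already applies. -/
theorem killedBy_covDeriv_riemann (hg : IsMetricOn g U) (hX : IsParallelOn g X U) (hy : y ∈ U) :
    KilledBy (X y) (covDeriv g (riemann g) y) := by
  have hk : ∀ z ∈ U, KilledBy (X z) (riemann g z) := fun z hz => killedBy_riemann hg hX hz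
  refine killedBy_covDeriv hg hX hg.smooth_riemann hk (fun z hz s => ?_) hy
  have hs : ∀ e, (Fin.snoc s e : Fin 5 → Fin n) = ![s 0, s 1, s 2, s 3, e] := fun e => by
    funext i; fin_cases i <;> rfl
  have hslot : ∀ (r : Fin 4) (t : Fin 5 → Fin n),
      ∑ e, X z e * covDeriv g (riemann g) z (Function.update t r.castSucc e) = 0 := by
    intro r t
    have h1 := ev_covDeriv_eq_zero hg hX hg.smooth_riemann r
      (fun z hz V hV => hk z hz V r hV) hz
      (Function.update (fun i => Pi.single (t i) 1) r.castSucc (X z)) (by simp)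
    rw [← h1, ev_update_single]
  have h2 : ∑ e, X z e * covDeriv g (riemann g) z ![s 0, s 1, s 3, e, s 2] = 0 := by
    rw [← hslot 3 ![s 0, s 1, s 3, s 3, s 2]]
    refine Finset.sum_congr rfl fun e _ => ?_
    congr 2
    funext i; fin_cases i <;> rfl
  have h3 : ∑ e, X z e * covDeriv g (riemann g) z ![s 0, s 1, e, s 2, s 3] = 0 := by
    rw [← hslot 2 ![s 0, s 1, s 3, s 2, s 3]]
    refine Finset.sum_congr rfl fun e _ => ?_
    congr 2
    funext i; fin_cases i <;> rfl
  have h4 : ∀ e, X z e * covDeriv g (riemann g) z (Fin.snoc s e)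
      = - (X z e * covDeriv g (riemann g) z ![s 0, s 1, s 3, e, s 2])
        - X z e * covDeriv g (riemann g) z ![s 0, s 1, e, s 2, s 3] := by
    intro e
    rw [hs]
    linear_combination X z e * hg.covDeriv_riemann_bianchi hz (s 0) (s 1) (s 2) (s 3) e
  simp only [h4, Finset.sum_sub_distrib, Finset.sum_neg_distrib, h2, h3]
  simp

/-- Two consecutive orders are carried along because the inductive step treats order p + 2 as a
second derivative of order p; order one is the separate Bianchi case. -/
theorem killedBy_riemannDeriv (hg : IsMetricOn g U) (hX : IsParallelOn g X U) (p : ℕ) :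
    (∀ y ∈ U, KilledBy (X y) (riemannDeriv g p y)) ∧
      ∀ y ∈ U, KilledBy (X y) (riemannDeriv g (p + 1) y) := by
  induction p with
  | zero => exact ⟨fun y hy => killedBy_riemann hg hX hy,
      fun y hy => killedBy_covDeriv_riemann hg hX hy⟩
  | succ p ih => exact ⟨ih.2, fun y hy =>
      killedBy_covDeriv_covDeriv hg hX (hg.smooth_riemannDeriv p) ih.2 hy⟩

theorem vanishesOnPerp_riemannDeriv (hg : IsMetricOn g U) (hX : IsParallelOn g X U)
    (hX0 : ∀ y ∈ U, X y ≠ 0) (h : ∀ y ∈ U, VanishesOnPerp (g y) (X y) (riemann g y)) (p : ℕ) :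
    ∀ y ∈ U, VanishesOnPerp (g y) (X y) (riemannDeriv g p y) := by
  induction p with
  | zero => exact h
  | succ p ih =>
    exact fun y hy => vanishesOnPerp_covDeriv hg hX hX0 (hg.smooth_riemannDeriv p) ih hy

end Parallel

/-! ## Null frames -/

namespace FrameIndex

variable {n : ℕ}

/-- The frame indices as `zero`, `one` and the spacelike ones. -/
def equivOption (n : ℕ) : Option (Option (Fin (n - 2))) ≃ FrameIndex n where
  toFun
    | none => .zero
    | some none => .one
    | some (some i) => .sp i
  invFun
    | .zero => none
    | .one => some none
    | .sp i => some (some i)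
  left_inv x := by rcases x with _ | _ | i <;> rfl
  right_inv x := by cases x <;> rfl

instance : Fintype (FrameIndex n) := Fintype.ofEquiv _ (equivOption n)

instance : DecidableEq (FrameIndex n) := (equivOption n).symm.decidableEq

theorem card (hn : 2 ≤ n) : Fintype.card (FrameIndex n) = n := by
  rw [Fintype.card_congr (equivOption n).symm]
  simp
  omega

theorem sum_eq {β : Type*} [AddCommMonoid β] (f : FrameIndex n → β) :
    ∑ I, f I = f .zero + (f .one + ∑ i, f (.sp i)) := by
  rw [← (equivOption n).sum_comp, Fintype.sum_option, Fintype.sum_option]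
  rfl

/-- The frame index dual to a given one. -/
def swap : FrameIndex n → FrameIndex n
  | .zero => .one
  | .one => .zero
  | .sp i => .sp i

theorem swap_swap (I : FrameIndex n) : I.swap.swap = I := by cases I <;> rfl

end FrameIndex

/-! ### Boost weights of index tuples -/

section BoostWeight

variable {n k : ℕ}

theorem boostWeight_update (I : Fin k → FrameIndex n) (r : Fin k) (L : FrameIndex n) :
    boostWeight (Function.update I r L) = boostWeight I - (I r).weight + L.weight := by
  have h : ∀ J : Fin k → FrameIndex n, boostWeight J
      = (J r).weight + ∑ r' ∈ Finset.univ.erase r, (J r').weight :=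
    fun J => (Finset.add_sum_erase _ _ (Finset.mem_univ r)).symm
  rw [h, h I, Function.update_self, Finset.sum_congr rfl fun r' hr' => by
    rw [Function.update_of_ne (Finset.ne_of_mem_erase hr')]]
  ring

theorem FrameIndex.weight_nonneg {L : FrameIndex n} (h : L ≠ .one) : 0 ≤ L.weight := by
  cases L <;> simp_all [FrameIndex.weight]

theorem FrameIndex.weight_nonpos {L : FrameIndex n} (h : L ≠ .zero) : L.weight ≤ 0 := by
  cases L <;> simp_all [FrameIndex.weight]

theorem exists_eq_one_of_boostWeight_neg {I : Fin k → FrameIndex n} (h : boostWeight I < 0) :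
    ∃ r, I r = .one := by
  by_contra! h1
  exact absurd (Finset.sum_nonneg fun r _ => FrameIndex.weight_nonneg (h1 r)) (not_le.2 h)

theorem exists_eq_zero_of_boostWeight_pos {I : Fin k → FrameIndex n} (h : 0 < boostWeight I) :
    ∃ r, I r = .zero := by
  by_contra! h1
  exact absurd (Finset.sum_nonpos fun r _ => FrameIndex.weight_nonpos (h1 r)) (not_le.2 h)

end BoostWeight

section Dot

variable {n : ℕ} {G : Matrix (Fin n) (Fin n) ℝ}

theorem dot_comm (hG : ∀ a b, G a b = G b a) (u v : Fin n → ℝ) : dot G u v = dot G v u := by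
  simp only [dot]
  rw [Finset.sum_comm]
  refine Finset.sum_congr rfl fun a _ => Finset.sum_congr rfl fun b _ => ?_
  rw [hG b a]
  ring

theorem dot_smul_left (c : ℝ) (u v : Fin n → ℝ) : dot G (c • u) v = c * dot G u v := by
  simp only [dot_eq_dotProduct, smul_dotProduct, smul_eq_mul]

theorem dot_add_left (u v w : Fin n → ℝ) : dot G (u + v) w = dot G u w + dot G v w := by
  simp only [dot_eq_dotProduct, add_dotProduct]

theorem dot_add_right (u v w : Fin n → ℝ) : dot G u (v + w) = dot G u v + dot G u w := by
  simp only [dot_eq_dotProduct, Matrix.mulVec_add, dotProduct_add]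

theorem dot_sum_left {ι : Type*} (s : Finset ι) (f : ι → Fin n → ℝ) (v : Fin n → ℝ) :
    dot G (∑ i ∈ s, f i) v = ∑ i ∈ s, dot G (f i) v := by
  simp only [dot_eq_dotProduct, sum_dotProduct]

theorem dot_sum_right {ι : Type*} (s : Finset ι) (f : ι → Fin n → ℝ) (v : Fin n → ℝ) :
    dot G v (∑ i ∈ s, f i) = ∑ i ∈ s, dot G v (f i) := by
  simp only [dot_eq_dotProduct, Matrix.mulVec_sum, dotProduct_sum]

end Dot

namespace NullFrame

variable {n k : ℕ} {G : Matrix (Fin n) (Fin n) ℝ}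

theorem comp_eq_ev (F : NullFrame G) (T : Tensor n k) (I : Fin k → FrameIndex n) :
    F.comp T I = ev T fun r => F.vec (I r) := by
  rw [ev_apply]
  exact Finset.sum_congr rfl fun s _ => mul_comm _ _

theorem comp_eq_zero_of_killedBy {F : NullFrame G} {T : Tensor n k} (h : KilledBy F.l T)
    {I : Fin k → FrameIndex n} {r : Fin k} (hr : I r = .zero) : F.comp T I = 0 := by
  rw [comp_eq_ev]
  exact h _ r (by rw [hr]; rfl)

/-- Exchanging the indices 0 and 1 yields the dual frame. -/
theorem dot_swap_vec (hG : ∀ a b, G a b = G b a) (F : NullFrame G) (I J : FrameIndex n) :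
    dot G (F.vec I.swap) (F.vec J) = if I = J then 1 else 0 := by
  cases I <;> cases J <;>
    simp [FrameIndex.swap, vec, F.l_l, F.nn_nn, F.l_nn, F.l_m, F.nn_m, F.m_m,
      dot_comm hG _ F.l, dot_comm hG (F.m _) F.nn]

theorem weight_of_dot_ne_zero (hG : ∀ a b, G a b = G b a) (F : NullFrame G) {I J : FrameIndex n}
    (h : dot G (F.vec I) (F.vec J) ≠ 0) : I.weight + J.weight = 0 := by
  rw [← I.swap_swap, dot_swap_vec hG] at h
  have : I.swap = J := by by_contra h'; simp [h'] at h
  subst this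
  cases I <;> rfl

/-- Duality says that the frame matrix has a left inverse. There are exactly n frame indices, so
this is also a right inverse, which is the completeness relation. -/
theorem sum_vec_mul_swap_mul (hn : 2 ≤ n) (hG : ∀ a b, G a b = G b a) (F : NullFrame G) :
    (Matrix.of fun a c => ∑ I, F.vec I a * F.vec I.swap c) * G = 1 := by
  let E : Matrix (Fin n) (FrameIndex n) ℝ := Matrix.of fun a I => F.vec I a
  let S : Matrix (FrameIndex n) (Fin n) ℝ := Matrix.of fun I c => F.vec I.swap c
  have h1 : S * G * E = 1 := by
    ext I J
    rw [Matrix.one_apply, ← dot_swap_vec hG F I J, dot_eq_dotProduct, Matrix.mul_assoc]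
    rfl
  have h2 : E * (S * G) = 1 :=
    (Matrix.mul_eq_one_comm_of_card_eq _ _ _ (by rw [FrameIndex.card hn, Fintype.card_fin])).1 h1
  rw [← h2, ← Matrix.mul_assoc]
  rfl

/-- The inverse metric in terms of a null frame. -/
theorem inv_apply (hn : 2 ≤ n) (hG : ∀ a b, G a b = G b a) (F : NullFrame G) (a b : Fin n) :
    G⁻¹ a b = ∑ I, F.vec I a * F.vec I.swap b := by
  rw [Matrix.inv_eq_left_inv (F.sum_vec_mul_swap_mul hn hG)]
  rfl

/-- The expansion of a vector in a null frame. -/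
theorem eq_sum_vec (hn : 2 ≤ n) (hG : ∀ a b, G a b = G b a) (F : NullFrame G) (v : Fin n → ℝ) :
    v = ∑ I, dot G (F.vec I.swap) v • F.vec I := by
  have h := congrArg (fun M => Matrix.mulVec M v) (F.sum_vec_mul_swap_mul hn hG)
  simp only [Matrix.one_mulVec, ← Matrix.mulVec_mulVec] at h
  refine h.symm.trans ?_
  funext a
  simp only [dot_eq_dotProduct, Matrix.mulVec, dotProduct, Matrix.of_apply, Finset.sum_apply,
    Pi.smul_apply, smul_eq_mul, Finset.sum_mul]
  rw [Finset.sum_comm]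
  refine Finset.sum_congr rfl fun I _ => Finset.sum_congr rfl fun c _ => ?_
  ring

theorem ev_eq_sum_comp (hn : 2 ≤ n) (hG : ∀ a b, G a b = G b a) (F : NullFrame G)
    (T : Tensor n k) (V : Fin k → Fin n → ℝ) :
    ev T V = ∑ I : Fin k → FrameIndex n, (∏ r, dot G (F.vec (I r).swap) (V r)) * F.comp T I := by
  have hV : V = fun r => ∑ I, dot G (F.vec I.swap) (V r) • F.vec I :=
    funext fun r => F.eq_sum_vec hn hG (V r)
  conv_lhs => rw [hV]
  rw [MultilinearMap.map_sum]
  refine Finset.sum_congr rfl fun I _ => ?_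
  rw [MultilinearMap.map_smul_univ, smul_eq_mul, comp_eq_ev]

theorem dot_self_eq (hn : 2 ≤ n) (hG : ∀ a b, G a b = G b a) (F : NullFrame G)
    (v : Fin n → ℝ) :
    dot G v v = 2 * (dot G F.nn v * dot G F.l v) + ∑ i, dot G (F.m i) v * dot G (F.m i) v := by
  have h : dot G v v = ∑ I : FrameIndex n, dot G (F.vec I.swap) v * dot G (F.vec I) v := by
    refine (congrArg (fun u => dot G u v) (F.eq_sum_vec hn hG v)).trans ?_
    rw [dot_sum_left]
    exact Finset.sum_congr rfl fun I _ => dot_smul_left _ _ _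
  rw [h, FrameIndex.sum_eq]
  simp only [FrameIndex.swap, vec]
  ring

/-- A null vector orthogonal to the null vector `l` of a frame is a multiple of it. -/
theorem eq_smul_l (hn : 2 ≤ n) (hG : ∀ a b, G a b = G b a) (F : NullFrame G) {v : Fin n → ℝ}
    (hvv : dot G v v = 0) (h : dot G F.l v = 0) : v = dot G F.nn v • F.l := by
  have hsq := F.dot_self_eq hn hG v
  rw [hvv, h, mul_zero, mul_zero, zero_add] at hsq
  have hsp : ∀ i, dot G (F.m i) v = 0 := fun i =>
    mul_self_eq_zero.1 ((Finset.sum_eq_zero_iff_of_nonneg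
      fun i _ => mul_self_nonneg _).1 hsq.symm i (Finset.mem_univ i))
  refine (F.eq_sum_vec hn hG v).trans ?_
  rw [FrameIndex.sum_eq]
  simp [FrameIndex.swap, vec, h, hsp]

/-- Turns annihilation by v into linear relations among the components in a frame that need not be
adapted to v. -/
theorem sum_dot_mul_comp_update (hn : 2 ≤ n) (hG : ∀ a b, G a b = G b a) (F : NullFrame G)
    {T : Tensor n k} {v : Fin n → ℝ} (hk : KilledBy v T) (I : Fin k → FrameIndex n) (r : Fin k) :
    ∑ L : FrameIndex n, dot G (F.vec L.swap) v * F.comp T (Function.update I r L) = 0 := by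
  rw [← hk (Function.update (fun r => F.vec (I r)) r
    (∑ L : FrameIndex n, dot G (F.vec L.swap) v • F.vec L)) r
    (by rw [Function.update_self]; exact (F.eq_sum_vec hn hG v).symm),
    MultilinearMap.map_update_sum]
  refine Finset.sum_congr rfl fun L _ => ?_
  rw [MultilinearMap.map_update_smul, smul_eq_mul, comp_eq_ev]
  congr 2
  funext r'
  by_cases h : r' = r
  · subst h; simp
  · simp [h]

/-- If only one term survives in the contraction of `T` with `v`, it vanishes. -/
theorem comp_eq_zero_of_update (hn : 2 ≤ n) (hG : ∀ a b, G a b = G b a) (F : NullFrame G)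
    {T : Tensor n k} {v : Fin n → ℝ} (hk : KilledBy v T) {I : Fin k → FrameIndex n} {r : Fin k}
    (hv : dot G (F.vec (I r).swap) v ≠ 0)
    (h : ∀ L, L ≠ I r → F.comp T (Function.update I r L) = 0) : F.comp T I = 0 := by
  have h2 := F.sum_dot_mul_comp_update hn hG hk I r
  rw [Finset.sum_eq_single (I r) (fun L _ hL => by rw [h L hL, mul_zero])
    (fun h => absurd (Finset.mem_univ _) h), Function.update_eq_self] at h2
  exact (mul_eq_zero.1 h2).resolve_left hv

/-- A tensor of negative boost order in some null frame and annihilated by a null vector `v`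
vanishes on the orthogonal complement of `v`. -/
theorem vanishesOnPerp_of_weightsIn (hn : 2 ≤ n) (hG : ∀ a b, G a b = G b a) (F : NullFrame G)
    {T : Tensor n k} (hT : F.WeightsIn T (Set.Iio 0)) {v : Fin n → ℝ} (hv : v ≠ 0)
    (hvv : dot G v v = 0) (hk : KilledBy v T) : VanishesOnPerp G v T := by
  intro V hV
  rw [F.ev_eq_sum_comp hn hG]
  refine Finset.sum_eq_zero fun I _ => ?_
  -- If v is orthogonal to `F.l`, it is a multiple of it, and an index 1 brings the factor l·V_r =
  -- 0. Otherwise all components of T turn out to vanish.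
  by_cases h1 : dot G F.l v = 0
  · have hvl := F.eq_smul_l hn hG hvv h1
    have hc0 : dot G F.nn v ≠ 0 := fun h => hv (by rw [hvl, h, zero_smul])
    by_cases hI : ∃ r, I r = .one
    · obtain ⟨r, hr⟩ := hI
      rw [Finset.prod_eq_zero (Finset.mem_univ r), zero_mul]
      rw [hr]
      have := hV r
      rw [hvl, dot_smul_left] at this
      exact (mul_eq_zero.1 this).resolve_left hc0
    · have : F.comp T I = 0 := by
        by_contra h
        exact hI (exists_eq_one_of_boostWeight_neg (hT I h))
      rw [this, mul_zero]
  · have key : ∀ (w : ℕ) (I : Fin k → FrameIndex n), -(w : ℤ) ≤ boostWeight I →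
        F.comp T I = 0 := by
      intro w
      induction w with
      | zero =>
        intro I hI
        by_contra h
        have := hT I h
        simp only [Set.mem_Iio] at this
        omega
      | succ w ih =>
        intro I hI
        by_cases hneg : boostWeight I < 0
        · obtain ⟨r, hr⟩ := exists_eq_one_of_boostWeight_neg hneg
          refine F.comp_eq_zero_of_update hn hG hk (r := r) (by rw [hr]; exact h1) fun L hL => ?_
          refine ih _ ?_
          rw [hr] at hL
          rw [boostWeight_update, hr]
          have h3 := FrameIndex.weight_nonneg hL
          have h5 : (FrameIndex.one : FrameIndex n).weight = -1 := rfl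
          push_cast at hI
          omega
        · exact ih I (by omega)
    rw [key (boostWeight I).natAbs I (by omega), mul_zero]

/-- A null vector of a Lorentzian scalar product is the first vector of a null frame. -/
theorem exists_nullFrame (hn : 2 ≤ n) (hG : ∀ a b, G a b = G b a) (B : Fin n → Fin n → ℝ)
    (hB : ∀ i j, dot G (B i) (B j) = if i = j then (if (i : ℕ) = 0 then -1 else 1) else 0)
    {v : Fin n → ℝ} (hv : v ≠ 0) (hvv : dot G v v = 0) : ∃ F : NullFrame G, F.l = v := by
  obtain ⟨k, rfl⟩ : ∃ k, n = k + 2 := ⟨n - 2, by omega⟩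
  let ε : Fin (k + 2) → ℝ := fun i => if (i : ℕ) = 0 then -1 else 1
  have hε : ∀ i, ε i * ε i = 1 := fun i => by
    simp only [ε]; split_ifs <;> norm_num
  have hexp : v = ∑ i, (ε i * dot G (B i) v) • B i := by
    -- The Gram relations make the matrix of the B_i invertible, the signs ε giving the dual basis;
    -- this yields the expansion of v.
    let E : Matrix (Fin (k + 2)) (Fin (k + 2)) ℝ := Matrix.of fun a i => B i a
    let S : Matrix (Fin (k + 2)) (Fin (k + 2)) ℝ := Matrix.of fun i c => ε i * B i c
    have h1 : S * G * E = 1 := by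
      ext i j
      have h2 : (S * G * E) i j = ε i * dot G (B i) (B j) := by
        rw [dot_eq_dotProduct, Matrix.mul_assoc]
        exact smul_dotProduct (ε i) (B i) (G.mulVec (B j))
      rw [h2, hB, Matrix.one_apply]
      by_cases h : i = j
      · rw [if_pos h, if_pos h]
        exact hε i
      · simp [h]
    have h2 : E * (S * G) = 1 := mul_eq_one_comm.1 h1
    have h := congrArg (fun M => Matrix.mulVec M v) h2
    simp only [Matrix.one_mulVec, ← Matrix.mulVec_mulVec] at h
    refine h.symm.trans ?_
    funext a
    have h3 : ∀ i, (S.mulVec (G.mulVec v)) i = ε i * dot G (B i) v := fun i => by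
      rw [dot_eq_dotProduct]
      exact smul_dotProduct (ε i) (B i) (G.mulVec v)
    simp only [Matrix.mulVec, dotProduct] at h3 ⊢
    simp only [h3, E, Matrix.of_apply, Finset.sum_apply, Pi.smul_apply, smul_eq_mul]
    exact Finset.sum_congr rfl fun i _ => mul_comm _ _
  -- The vector v splits into t B_0 and a spatial part w in Euclidean space; nullity means |w|² =
  -- t², so neither part vanishes.
  set t : ℝ := ε 0 * dot G (B 0) v with ht
  let w : EuclideanSpace ℝ (Fin (k + 1)) :=
    WithLp.toLp 2 fun i => ε i.succ * dot G (B i.succ) v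
  let sp : EuclideanSpace ℝ (Fin (k + 1)) → Fin (k + 2) → ℝ := fun u => ∑ i, u i • B i.succ
  have hvw : v = t • B 0 + sp w := by
    conv_lhs => rw [hexp, Fin.sum_univ_succ]
  have h00 : dot G (B 0) (B 0) = -1 := by simp [hB]
  have h0s : ∀ u, dot G (B 0) (sp u) = 0 := fun u => by
    simp only [sp, dot_sum_right, dot_smul_right, hB]
    exact Finset.sum_eq_zero fun i _ => by simp [(Fin.succ_ne_zero i).symm]
  have hss : ∀ u u', dot G (sp u) (sp u') = inner ℝ u u' := fun u u' => by
    simp only [sp, dot_sum_right, dot_smul_right, dot_sum_left, dot_smul_left, hB]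
    simp [PiLp.inner_apply, mul_comm]
  have hs0 : ∀ u, dot G (sp u) (B 0) = 0 := fun u => by rw [dot_comm hG, h0s]
  have hnorm : inner ℝ w w = t * t := by
    have := hvv
    rw [hvw] at this
    simp only [dot_add_left, dot_add_right, dot_smul_left, dot_smul_right, h00, h0s, hs0, hss]
      at this
    linarith
  have ht0 : t ≠ 0 := by
    intro h
    rw [h, mul_zero, inner_self_eq_zero] at hnorm
    apply hv
    rw [hvw, h, hnorm]
    simp [sp]
  have hw0 : w ≠ 0 := fun h => by
    rw [h, inner_zero_left] at hnorm
    exact ht0 (mul_self_eq_zero.1 hnorm.symm)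
  have hu1 : ‖(‖w‖⁻¹ • w : EuclideanSpace ℝ (Fin (k + 1)))‖ = 1 := by
    rw [norm_smul, norm_inv, norm_norm, inv_mul_cancel₀ (norm_ne_zero_iff.2 hw0)]
  -- An orthonormal basis with b_0 = w/|w|; the other k = n - 2 vectors become the spacelike frame
  -- vectors.
  obtain ⟨b, hb⟩ := Orthonormal.exists_orthonormalBasis_extension_of_card_eq
    (ι := Fin (k + 1)) (𝕜 := ℝ) (E := EuclideanSpace ℝ (Fin (k + 1))) (by simp)
    (v := fun _ => ‖w‖⁻¹ • w) (s := {0}) (by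
      refine ⟨fun i => hu1, fun i j hij => (hij (Subsingleton.elim i j)).elim⟩)
  have hb0 : w = ‖w‖ • b 0 := by
    rw [hb 0 rfl, smul_smul, mul_inv_cancel₀ (norm_ne_zero_iff.2 hw0), one_smul]
  have hbo := orthonormal_iff_ite.1 b.orthonormal
  have hwb : ∀ i : Fin k, inner ℝ w (b i.succ) = 0 := fun i => by
    rw [hb0, inner_smul_left, hbo]
    simp [(Fin.succ_ne_zero i).symm]
  have htt : t * t ≠ 0 := mul_ne_zero ht0 ht0
  refine ⟨{
    l := v
    -- The time reflection of v, whose product with v is t² + |w|² = 2t².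
    nn := (1 / (2 * (t * t))) • ((-t) • B 0 + sp w)
    m := fun i => sp (b (Fin.succ i))
    l_l := hvv
    nn_nn := ?_
    l_nn := ?_
    l_m := ?_
    nn_m := ?_
    m_m := ?_ }, rfl⟩
  · simp only [dot_add_left, dot_add_right, dot_smul_left, dot_smul_right, h00, h0s, hs0, hss,
      hnorm]
    ring
  · rw [hvw]
    simp only [dot_add_left, dot_add_right, dot_smul_left, dot_smul_right, h00, h0s, hs0, hss,
      hnorm]
    field_simp
    ring
  · intro i
    rw [hvw]
    simp only [dot_add_left, dot_smul_left, h0s, hss]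
    rw [hwb]
    simp
  · intro i
    simp only [dot_add_left, dot_smul_left, h0s, hss]
    rw [hwb]
    simp
  · intro i j
    rw [hss, hbo]
    simp

end NullFrame

/-! ## Vanishing of scalar invariants -/

/-- The complete contractions of tensors that are annihilated by a null vector `ℓ` and vanish on
its orthogonal complement are zero. -/
theorem contraction_eq_zero {n m q : ℕ} (hn : 2 ≤ n) {g : MetricField n} {y : Coord n}
    (hG : ∀ a b, g y a b = g y b a) (F : NullFrame (g y)) (hm : 0 < m) (k : Fin m → ℕ)
    (hk : ∀ i, KilledBy F.l (riemannDeriv g (k i) y))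
    (hp : ∀ i, VanishesOnPerp (g y) F.l (riemannDeriv g (k i) y))
    (σ : (Σ i : Fin m, Fin (4 + k i)) ≃ Fin q ⊕ Fin q) : contraction g k σ y = 0 := by
  -- In the frame, g⁻¹ is the sum of e_I ⊗ e_{swap I}, so the two slots of a contracted pair carry
  -- dual frame indices.
  let J : (Fin q → FrameIndex n) → Fin q ⊕ Fin q → FrameIndex n :=
    fun I => Sum.elim I fun j => (I j).swap
  have h1 : contraction g k σ y = ∑ I : Fin q → FrameIndex n,
      ∏ i, F.comp (riemannDeriv g (k i) y) fun r => J I (σ ⟨i, r⟩) := by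
    have h2 : ∀ a : Fin q ⊕ Fin q → Fin n,
        ∏ j, (g y)⁻¹ (a (Sum.inl j)) (a (Sum.inr j))
          = ∑ I : Fin q → FrameIndex n, ∏ x, F.vec (J I x) (a x) := by
      intro a
      simp only [F.inv_apply hn hG]
      rw [Finset.prod_univ_sum, Fintype.piFinset_univ]
      refine Finset.sum_congr rfl fun I _ => ?_
      rw [Fintype.prod_sum_type, ← Finset.prod_mul_distrib]
      rfl
    unfold contraction
    simp only [h2, Finset.sum_mul]
    rw [Finset.sum_comm]
    refine Finset.sum_congr rfl fun I _ => ?_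
    unfold NullFrame.comp
    rw [Finset.prod_univ_sum, Fintype.piFinset_univ]
    -- Via σ, an index assignment on all slots is a family of assignments, one for each factor.
    refine Fintype.sum_equiv ((Equiv.arrowCongr σ.symm (Equiv.refl (Fin n))).trans
      (Equiv.piCurry fun _ _ => Fin n)) _ _ fun a => ?_
    rw [Finset.prod_mul_distrib, ← σ.prod_comp, Fintype.prod_sigma]
    rfl
  rw [h1]
  refine Finset.sum_eq_zero fun I _ => ?_
  by_contra h
  have hne : ∀ i, F.comp (riemannDeriv g (k i) y) (fun r => J I (σ ⟨i, r⟩)) ≠ 0 :=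
    fun i => Finset.prod_ne_zero_iff.1 h i (Finset.mem_univ i)
  have hzero : ∀ x, J I x ≠ .zero := by
    intro x hx
    obtain ⟨⟨i, r⟩, rfl⟩ := σ.surjective x
    exact hne i (NullFrame.comp_eq_zero_of_killedBy (hk i) hx)
  -- Otherwise the first factor, present since m > 0, would be evaluated on spacelike frame vectors
  -- only, all orthogonal to ℓ.
  have hone : ∃ x, J I x = .one := by
    by_contra! hx
    refine hne ⟨0, hm⟩ ?_
    rw [NullFrame.comp_eq_ev]
    refine hp ⟨0, hm⟩ _ fun r => ?_
    have h3 := hx (σ ⟨⟨0, hm⟩, r⟩)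
    have h4 := hzero (σ ⟨⟨0, hm⟩, r⟩)
    revert h3 h4
    cases J I (σ ⟨⟨0, hm⟩, r⟩) with
    | zero => simp
    | one => simp
    | sp i => exact fun _ _ => F.l_m i
  obtain ⟨x, hx⟩ := hone
  rcases x with j | j
  · refine hzero (Sum.inr j) ?_
    simp only [J, Sum.elim_inl, Sum.elim_inr] at hx ⊢
    rw [hx]
    rfl
  · refine hzero (Sum.inl j) ?_
    simp only [J, Sum.elim_inl, Sum.elim_inr] at hx ⊢
    rw [← (I j).swap_swap, hx]
    rfl

/-! ## Alignment types of tensors annihilated by a null vector -/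

/-- The algebraic symmetries of a curvature tensor (apart from the cyclic identity). -/
structure CurvatureSymm {n : ℕ} (C : Tensor n 4) : Prop where
  left : ∀ a b c d, C ![a, b, c, d] = - C ![b, a, c, d]
  right : ∀ a b c d, C ![a, b, c, d] = - C ![a, b, d, c]
  pair : ∀ a b c d, C ![a, b, c, d] = C ![c, d, a, b]

namespace NullFrame

variable {n k : ℕ} {G : Matrix (Fin n) (Fin n) ℝ}

theorem comp_four (F : NullFrame G) (C : Tensor n 4) (I J K L : FrameIndex n) :
    F.comp C ![I, J, K, L] = ∑ a, ∑ b, ∑ c, ∑ d,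
      C ![a, b, c, d] * (F.vec I a * F.vec J b * F.vec K c * F.vec L d) := by
  rw [comp_eq_ev, ev_four]
  simp

theorem comp_left (F : NullFrame G) {C : Tensor n 4} (hC : CurvatureSymm C)
    (I J K L : FrameIndex n) : F.comp C ![I, J, K, L] = - F.comp C ![J, I, K, L] := by
  rw [comp_four, comp_four, Finset.sum_comm]
  simp only [← Finset.sum_neg_distrib]
  refine Finset.sum_congr rfl fun a _ => Finset.sum_congr rfl fun b _ =>
    Finset.sum_congr rfl fun c _ => Finset.sum_congr rfl fun d _ => ?_
  rw [hC.left b a c d]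
  ring

theorem comp_right (F : NullFrame G) {C : Tensor n 4} (hC : CurvatureSymm C)
    (I J K L : FrameIndex n) : F.comp C ![I, J, K, L] = - F.comp C ![I, J, L, K] := by
  rw [comp_four, comp_four]
  simp only [← Finset.sum_neg_distrib]
  refine Finset.sum_congr rfl fun a _ => Finset.sum_congr rfl fun b _ => ?_
  rw [Finset.sum_comm]
  refine Finset.sum_congr rfl fun c _ => Finset.sum_congr rfl fun d _ => ?_
  rw [hC.right a b d c]
  ring

theorem comp_pair (F : NullFrame G) {C : Tensor n 4} (hC : CurvatureSymm C)
    (I J K L : FrameIndex n) : F.comp C ![I, J, K, L] = F.comp C ![K, L, I, J] := by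
  rw [comp_four, comp_four]
  calc _ = ∑ a, ∑ c, ∑ b, ∑ d,
        C ![a, b, c, d] * (F.vec I a * F.vec J b * F.vec K c * F.vec L d) :=
        Finset.sum_congr rfl fun a _ => Finset.sum_comm
    _ = ∑ c, ∑ a, ∑ b, ∑ d,
        C ![a, b, c, d] * (F.vec I a * F.vec J b * F.vec K c * F.vec L d) := Finset.sum_comm
    _ = ∑ c, ∑ a, ∑ d, ∑ b,
        C ![a, b, c, d] * (F.vec I a * F.vec J b * F.vec K c * F.vec L d) :=
        Finset.sum_congr rfl fun c _ => Finset.sum_congr rfl fun a _ => Finset.sum_comm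
    _ = ∑ c, ∑ d, ∑ a, ∑ b,
        C ![a, b, c, d] * (F.vec I a * F.vec J b * F.vec K c * F.vec L d) :=
        Finset.sum_congr rfl fun c _ => Finset.sum_comm
    _ = _ := by
        refine Finset.sum_congr rfl fun c _ => Finset.sum_congr rfl fun d _ =>
          Finset.sum_congr rfl fun a _ => Finset.sum_congr rfl fun b _ => ?_
        rw [hC.pair]
        ring

/-- The trace of a tensor in a null frame. -/
theorem sum_comp_swap (hn : 2 ≤ n) (hG : ∀ a b, G a b = G b a) (F : NullFrame G) {C : Tensor n 4}
    (hC : ∀ a b, ∑ c, ∑ d, G⁻¹ c d * C ![c, a, d, b] = 0) (I J : FrameIndex n) :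
    ∑ K : FrameIndex n, F.comp C ![K, I, K.swap, J] = 0 := by
  have h : ∀ K : FrameIndex n, F.comp C ![K, I, K.swap, J]
      = ∑ b, ∑ d, F.vec I b * F.vec J d *
        ∑ a, ∑ c, F.vec K a * F.vec K.swap c * C ![a, b, c, d] := by
    intro K
    rw [comp_four, Finset.sum_comm]
    refine Finset.sum_congr rfl fun b _ => ?_
    simp only [Finset.mul_sum]
    rw [Finset.sum_comm (s := (Finset.univ : Finset (Fin n)))
      (f := fun d a => ∑ c, F.vec I b * F.vec J d *
        (F.vec K a * F.vec K.swap c * C ![a, b, c, d]))]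
    refine Finset.sum_congr rfl fun a _ => ?_
    rw [Finset.sum_comm]
    exact Finset.sum_congr rfl fun d _ => Finset.sum_congr rfl fun c _ => by ring
  simp only [h]
  rw [Finset.sum_comm]
  refine Finset.sum_eq_zero fun b _ => ?_
  rw [Finset.sum_comm]
  refine Finset.sum_eq_zero fun d _ => ?_
  rw [← Finset.mul_sum, Finset.sum_comm]
  have h2 : ∑ a, ∑ K : FrameIndex n, ∑ c, F.vec K a * F.vec K.swap c * C ![a, b, c, d] = 0 := by
    rw [← hC b d]
    refine Finset.sum_congr rfl fun a _ => ?_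
    rw [Finset.sum_comm]
    refine Finset.sum_congr rfl fun c _ => ?_
    rw [F.inv_apply hn hG, Finset.sum_mul]
  rw [h2, mul_zero]

/-- A tensor with only components of boost weight `0` annihilated by a null vector: the components
with both an index `0` and an index `1` vanish. -/
theorem comp_eq_zero_of_weightsIn_zero (hn : 2 ≤ n) (hG : ∀ a b, G a b = G b a) (F : NullFrame G)
    {T : Tensor n k} (hT : F.WeightsIn T {0}) {v : Fin n → ℝ} (hv : v ≠ 0) (hvv : dot G v v = 0)
    (hk : KilledBy v T) {I : Fin k → FrameIndex n} {r r' : Fin k} (hr : I r = .zero)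
    (hr' : I r' = .one) : F.comp T I = 0 := by
  by_contra hne
  have hI : boostWeight I = 0 := hT I hne
  -- Changing a single index to one of another weight leaves boost weight 0, so the contraction with
  -- v retains only one term. The slot used carries the index 0 if v is parallel to l, and the index
  -- 1 otherwise.
  have hw : ∀ (r : Fin k) (L : FrameIndex n), L.weight ≠ (I r).weight →
      F.comp T (Function.update I r L) = 0 := by
    intro r L hL
    by_contra h
    have := hT _ h
    rw [Set.mem_singleton_iff, boostWeight_update] at this
    omega
  by_cases h1 : dot G F.l v = 0
  · have hc0 : dot G F.nn v ≠ 0 := fun h => hv (by rw [F.eq_smul_l hn hG hvv h1, h, zero_smul])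
    refine hne (F.comp_eq_zero_of_update hn hG hk (r := r) (by rw [hr]; exact hc0) fun L hL => ?_)
    refine hw r L ?_
    rw [hr] at hL ⊢
    cases L <;> simp_all [FrameIndex.weight]
  · refine hne (F.comp_eq_zero_of_update hn hG hk (r := r') (by rw [hr']; exact h1) fun L hL => ?_)
    refine hw r' L ?_
    rw [hr'] at hL ⊢
    cases L <;> simp_all [FrameIndex.weight]

/-- A tensor with only components of negative boost weight annihilated by a null vector: the
components of boost weight `-1` with an index `0` vanish. -/
theorem comp_eq_zero_of_weightsIn_neg (hn : 2 ≤ n) (hG : ∀ a b, G a b = G b a) (F : NullFrame G)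
    {T : Tensor n k} (hT : F.WeightsIn T (Set.Iio 0)) {v : Fin n → ℝ} (hv : v ≠ 0)
    (hvv : dot G v v = 0) (hk : KilledBy v T) {I : Fin k → FrameIndex n}
    (hI : boostWeight I = -1) {r : Fin k} (hr : I r = .zero) : F.comp T I = 0 := by
  by_cases h1 : dot G F.l v = 0
  · have hvl := F.eq_smul_l hn hG hvv h1
    have hc0 : dot G F.nn v ≠ 0 := fun h => hv (by rw [hvl, h, zero_smul])
    have h := hk (Function.update (fun r => F.vec (I r)) r (dot G F.nn v • F.l)) r
      (by rw [Function.update_self]; exact hvl.symm)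
    rw [MultilinearMap.map_update_smul, smul_eq_mul] at h
    rw [comp_eq_ev, ← (mul_eq_zero.1 h).resolve_left hc0]
    congr 1
    exact (Function.update_eq_self_iff.2 (by rw [hr]; rfl)).symm
  · obtain ⟨r', hr'⟩ := exists_eq_one_of_boostWeight_neg (I := I) (by omega)
    refine F.comp_eq_zero_of_update hn hG hk (r := r') (by rw [hr']; exact h1) fun L hL => ?_
    by_contra h
    have := hT _ h
    rw [Set.mem_Iio, boostWeight_update, hr', hI] at this
    rw [hr'] at hL
    have h3 := FrameIndex.weight_nonneg hL
    have h5 : (FrameIndex.one : FrameIndex n).weight = -1 := rfl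
    omega

end NullFrame

section Types

variable {n : ℕ} {G : Matrix (Fin n) (Fin n) ℝ} {C : Tensor n 4}

theorem weightsIn_of_killedBy {k : ℕ} {T : Tensor n k} (F : NullFrame G)
    (hk : KilledBy F.l T) : F.WeightsIn T (Set.Iic 0) := by
  intro I hI
  by_contra h
  obtain ⟨r, hr⟩ := exists_eq_zero_of_boostWeight_pos (not_le.1 h)
  exact hI (NullFrame.comp_eq_zero_of_killedBy hk hr)

/-- Each of Φ, Φ_{ij} and Ψ'_i carries an index 0. -/
theorem typeII'abd_of_killedBy (F : NullFrame G) (hk : KilledBy F.l C) (h0 : C ≠ 0) :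
    TypeII'abd G C := by
  have h1 : F.Phi0 C = 0 := NullFrame.comp_eq_zero_of_killedBy hk (r := 0) rfl
  have h2 : ∀ i j, F.Phi2 C i j = 0 :=
    fun i j => NullFrame.comp_eq_zero_of_killedBy hk (r := 0) rfl
  refine ⟨h0, F, weightsIn_of_killedBy F hk, h1, fun i j => ?_, fun i j => ?_, fun i =>
    NullFrame.comp_eq_zero_of_killedBy hk (r := 1) rfl⟩
  · simp [h1, h2]
  · simp [h2]

/-- The frame of type D need not contain v, but Φ and Φ_{ij} have indices 0 and 1 at once, so
`NullFrame.comp_eq_zero_of_weightsIn_zero` applies. -/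
theorem TypeD.typeDabd (hn : 2 ≤ n) (hG : ∀ a b, G a b = G b a) (h : TypeD G C)
    {v : Fin n → ℝ} (hv : v ≠ 0) (hvv : dot G v v = 0) (hk : KilledBy v C) : TypeDabd G C := by
  obtain ⟨h0, F, hF⟩ := h
  have h1 : F.Phi0 C = 0 :=
    F.comp_eq_zero_of_weightsIn_zero hn hG hF hv hvv hk (r := 0) (r' := 1) rfl rfl
  have h2 : ∀ i j, F.Phi2 C i j = 0 := fun i j =>
    F.comp_eq_zero_of_weightsIn_zero hn hG hF hv hvv hk (r := 0) (r' := 2) rfl rfl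
  refine ⟨h0, F, hF, h1, fun i j => ?_, fun i j => ?_⟩
  · simp [h1, h2]
  · simp [h2]

/-- Again in an arbitrary frame: Ψ'_i has boost weight -1 and an index 0. -/
theorem TypeIII.typeIIIa (hn : 2 ≤ n) (hG : ∀ a b, G a b = G b a) (h : TypeIII G C)
    {v : Fin n → ℝ} (hv : v ≠ 0) (hvv : dot G v v = 0) (hk : KilledBy v C) : TypeIIIa G C := by
  obtain ⟨h0, F, hF⟩ := h
  refine ⟨h0, F, hF, fun i =>
    F.comp_eq_zero_of_weightsIn_neg hn hG hF hv hvv hk ?_ (r := 1) rfl⟩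
  simp [boostWeight, Fin.sum_univ_four, FrameIndex.weight]

theorem TypeIIIa.typeIII (h : TypeIIIa G C) : TypeIII G C :=
  let ⟨h0, F, hF, _⟩ := h
  ⟨h0, F, hF⟩

theorem TypeN.typeIII (h : TypeN G C) : TypeIII G C := by
  obtain ⟨h0, F, hF⟩ := h
  refine ⟨h0, F, fun I hI => ?_⟩
  have h1 : boostWeight I = -2 := hF I hI
  rw [Set.mem_Iio, h1]
  norm_num

end Types

/-! ### Tracefree curvature tensors in low dimensions -/

/-- The single independent component S_{0101} is itself a trace. -/
theorem curvature_eq_zero_of_dim_two {S : Fin 2 → Fin 2 → Fin 2 → Fin 2 → ℝ}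
    (hl : ∀ i j k l, S i j k l = - S j i k l) (hr : ∀ i j k l, S i j k l = - S i j l k)
    (ht : ∀ i j, ∑ k, S k i k j = 0) (i j k l : Fin 2) : S i j k l = 0 := by
  have hl0 : ∀ i k l, S i i k l = 0 := fun i k l => by linarith [hl i i k l]
  have hr0 : ∀ i j k, S i j k k = 0 := fun i j k => by linarith [hr i j k k]
  have h0 : S 0 1 0 1 = 0 := by
    have := ht 1 1
    rw [Fin.sum_univ_two, hl0] at this
    linarith
  have h1 : ∀ k l, S 0 1 k l = 0 := by
    intro k l
    fin_cases k <;> fin_cases l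
    · exact hr0 _ _ _
    · exact h0
    · exact (hr _ _ _ _).trans (neg_eq_zero.2 h0)
    · exact hr0 _ _ _
  fin_cases i <;> fin_cases j
  · exact hl0 _ _ _
  · exact h1 _ _
  · exact (hl _ _ _ _).trans (neg_eq_zero.2 (h1 _ _))
  · exact hl0 _ _ _

/-- The diagonal traces make the three sectional components sum to zero in pairs, so all three
vanish; each off-diagonal trace contains one remaining component. -/
theorem curvature_eq_zero_of_dim_three {S : Fin 3 → Fin 3 → Fin 3 → Fin 3 → ℝ}
    (hl : ∀ i j k l, S i j k l = - S j i k l) (hr : ∀ i j k l, S i j k l = - S i j l k)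
    (ht : ∀ i j, ∑ k, S k i k j = 0) (i j k l : Fin 3) : S i j k l = 0 := by
  have hl0 : ∀ i k l, S i i k l = 0 := fun i k l => by linarith [hl i i k l]
  have hr0 : ∀ i j k, S i j k k = 0 := fun i j k => by linarith [hr i j k k]
  simp only [Fin.sum_univ_three] at ht
  have hd : ∀ i j, S i j i j = S j i j i := fun i j => by linarith [hl i j i j, hr j i i j]
  have d01 : S 0 1 0 1 = 0 := by
    linarith [ht 0 0, ht 1 1, ht 2 2, hl0 0 0 0, hl0 1 1 1, hl0 2 2 2, hd 0 1, hd 0 2, hd 1 2]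
  have d02 : S 0 2 0 2 = 0 := by
    linarith [ht 0 0, ht 1 1, ht 2 2, hl0 0 0 0, hl0 1 1 1, hl0 2 2 2, hd 0 1, hd 0 2, hd 1 2]
  have d12 : S 1 2 1 2 = 0 := by
    linarith [ht 0 0, ht 1 1, ht 2 2, hl0 0 0 0, hl0 1 1 1, hl0 2 2 2, hd 0 1, hd 0 2, hd 1 2]
  have o1 : S 0 1 0 2 = 0 := by linarith [ht 1 2, hl0 1 1 2, hr0 2 1 2]
  have o2 : S 0 2 0 1 = 0 := by linarith [ht 2 1, hl0 2 2 1, hr0 1 2 1]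
  have o3 : S 1 0 1 2 = 0 := by linarith [ht 0 2, hl0 0 0 2, hr0 2 0 2]
  have o4 : S 1 2 1 0 = 0 := by linarith [ht 2 0, hl0 2 2 0, hr0 0 2 0]
  have o5 : S 2 0 2 1 = 0 := by linarith [ht 0 1, hl0 0 0 1, hr0 1 0 1]
  have o6 : S 2 1 2 0 = 0 := by linarith [ht 1 0, hl0 1 1 0, hr0 0 1 0]
  have hl' : ∀ {i j k l}, S i j k l = 0 → S j i k l = 0 := fun {i j k l} h => by
    rw [hl, h, neg_zero]
  have hr' : ∀ {i j k l}, S i j k l = 0 → S i j l k = 0 := fun {i j k l} h => by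
    rw [hr, h, neg_zero]
  have h01 : ∀ k l, S 0 1 k l = 0 := by
    intro k l
    fin_cases k <;> fin_cases l
    exacts [hr0 _ _ _, d01, o1, hr' d01, hr0 _ _ _, hl' o3, hr' o1, hr' (hl' o3), hr0 _ _ _]
  have h02 : ∀ k l, S 0 2 k l = 0 := by
    intro k l
    fin_cases k <;> fin_cases l
    exacts [hr0 _ _ _, o2, d02, hr' o2, hr0 _ _ _, hr' (hl' o5), hr' d02, hl' o5, hr0 _ _ _]
  have h12 : ∀ k l, S 1 2 k l = 0 := by
    intro k l
    fin_cases k <;> fin_cases l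
    exacts [hr0 _ _ _, hr' o4, hr' (hl' o6), o4, hr0 _ _ _, d12, hl' o6, hr' d12, hr0 _ _ _]
  fin_cases i <;> fin_cases j
  exacts [hl0 _ _ _, h01 _ _, h02 _ _, hl' (h01 _ _), hl0 _ _ _, h12 _ _, hl' (h02 _ _),
    hl' (h12 _ _), hl0 _ _ _]

/-- Serves the components C_{1ijk} for n = 4: both independent components are traces. -/
theorem eq_zero_of_dim_two {B : Fin 2 → Fin 2 → Fin 2 → ℝ}
    (hr : ∀ i j k, B i j k = - B i k j) (ht : ∀ i, ∑ k, B k k i = 0) (i j k : Fin 2) :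
    B i j k = 0 := by
  have hr0 : ∀ i j, B i j j = 0 := fun i j => by linarith [hr i j j]
  simp only [Fin.sum_univ_two] at ht
  have h0 : B 0 0 1 = 0 := by linarith [ht 1, hr0 1 1]
  have h1 : B 1 1 0 = 0 := by linarith [ht 0, hr0 0 0]
  fin_cases i <;> fin_cases j <;> fin_cases k
  exacts [hr0 _ _, h0, (hr _ _ _).trans (neg_eq_zero.2 h0), hr0 _ _, hr0 _ _,
    (hr _ _ _).trans (neg_eq_zero.2 h1), h1, hr0 _ _]

section LowDimension

variable {n : ℕ} {G : Matrix (Fin n) (Fin n) ℝ} {C : Tensor n 4}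

/-- The trace over the spacelike frame vectors of a tracefree tensor annihilated by `l`. -/
theorem sum_comp_sp (hn : 2 ≤ n) (hG : ∀ a b, G a b = G b a) (F : NullFrame G)
    (hk : KilledBy F.l C) (hC : ∀ a b, ∑ c, ∑ d, G⁻¹ c d * C ![c, a, d, b] = 0)
    (I J : FrameIndex n) : ∑ k, F.comp C ![.sp k, I, .sp k, J] = 0 := by
  have h := F.sum_comp_swap hn hG hC I J
  rw [FrameIndex.sum_eq, NullFrame.comp_eq_zero_of_killedBy hk (r := 0) rfl,
    NullFrame.comp_eq_zero_of_killedBy hk (r := 2) rfl, zero_add, zero_add] at h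
  exact h

theorem comp_sp_eq_zero (hn : n = 4 ∨ n = 5) (hG : ∀ a b, G a b = G b a) (F : NullFrame G)
    (hk : KilledBy F.l C) (hs : CurvatureSymm C)
    (hC : ∀ a b, ∑ c, ∑ d, G⁻¹ c d * C ![c, a, d, b] = 0) (i j k l : Fin (n - 2)) :
    F.comp C ![.sp i, .sp j, .sp k, .sp l] = 0 := by
  rcases hn with rfl | rfl
  · exact curvature_eq_zero_of_dim_two
      (S := fun i j k l => F.comp C ![.sp i, .sp j, .sp k, .sp l])
      (fun _ _ _ _ => F.comp_left hs _ _ _ _) (fun _ _ _ _ => F.comp_right hs _ _ _ _)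
      (fun _ _ => sum_comp_sp (by norm_num) hG F hk hC _ _) i j k l
  · exact curvature_eq_zero_of_dim_three
      (S := fun i j k l => F.comp C ![.sp i, .sp j, .sp k, .sp l])
      (fun _ _ _ _ => F.comp_left hs _ _ _ _) (fun _ _ _ _ => F.comp_right hs _ _ _ _)
      (fun _ _ => sum_comp_sp (by norm_num) hG F hk hC _ _) i j k l

theorem eq_vec_four {α : Type*} (I : Fin 4 → α) : I = ![I 0, I 1, I 2, I 3] := by
  funext r; fin_cases r <;> rfl

theorem FrameIndex.eq_one_or_sp {I : FrameIndex n} (h : I ≠ .zero) :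
    I = .one ∨ ∃ i, I = .sp i := by
  cases I <;> simp_all

/-- In dimension `5` a nonzero tracefree curvature tensor annihilated by a null vector is of
type III. -/
theorem typeIII_of_dim_five (hn : n = 5) (hG : ∀ a b, G a b = G b a) (F : NullFrame G)
    (hk : KilledBy F.l C) (hs : CurvatureSymm C)
    (hC : ∀ a b, ∑ c, ∑ d, G⁻¹ c d * C ![c, a, d, b] = 0) (h0 : C ≠ 0) : TypeIII G C := by
  refine ⟨h0, F, fun I hI => ?_⟩
  have hz : ∀ r, I r ≠ .zero := fun r hr => hI (NullFrame.comp_eq_zero_of_killedBy hk hr)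
  have hle : boostWeight I ≤ 0 := weightsIn_of_killedBy F hk I hI
  refine lt_of_le_of_ne hle fun hw => hI ?_
  -- Without an index 0 all weights are nonpositive, so total weight 0 forces every index to be
  -- spacelike.
  have hsp : ∀ r, ∃ i, I r = .sp i := by
    intro r
    refine (FrameIndex.eq_one_or_sp (hz r)).resolve_left fun hr => ?_
    have := (Finset.sum_eq_zero_iff_of_nonpos
      (fun r _ => FrameIndex.weight_nonpos (hz r))).1 hw r (Finset.mem_univ r)
    rw [hr] at this
    simp [FrameIndex.weight] at this
  choose i hi using hsp
  rw [eq_vec_four I, hi, hi, hi, hi]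
  exact comp_sp_eq_zero (Or.inr hn) hG F hk hs hC _ _ _ _

/-- In dimension `4` a nonzero tracefree curvature tensor annihilated by a null vector is of
type N. -/
theorem typeN_of_dim_four (hn : n = 4) (hG : ∀ a b, G a b = G b a) (F : NullFrame G)
    (hk : KilledBy F.l C) (hs : CurvatureSymm C)
    (hC : ∀ a b, ∑ c, ∑ d, G⁻¹ c d * C ![c, a, d, b] = 0) (h0 : C ≠ 0) : TypeN G C := by
  refine ⟨h0, F, fun I hI => ?_⟩
  have hz : ∀ r, I r ≠ .zero := fun r hr => hI (NullFrame.comp_eq_zero_of_killedBy hk hr)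
  have hB : ∀ i j k, F.comp C ![.one, .sp i, .sp j, .sp k] = 0 := by
    subst hn
    exact eq_zero_of_dim_two (B := fun i j k => F.comp C ![.one, .sp i, .sp j, .sp k])
      (fun _ _ _ => F.comp_right hs _ _ _ _) fun i => by
        rw [← neg_eq_zero, ← Finset.sum_neg_distrib,
          ← sum_comp_sp (by norm_num) hG F hk hC .one (.sp i)]
        exact Finset.sum_congr rfl fun k _ => (F.comp_left hs _ _ _ _).symm
  have hS := comp_sp_eq_zero (Or.inl hn) hG F hk hs hC
  have hl : ∀ K L, F.comp C ![.one, .one, K, L] = 0 := fun K L => by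
    linarith [F.comp_left hs .one .one K L]
  have hr : ∀ K L, F.comp C ![K, L, .one, .one] = 0 := fun K L => by
    linarith [F.comp_right hs K L .one .one]
  rw [Set.mem_singleton_iff]
  by_contra hw
  refine hI ?_
  rw [boostWeight, Fin.sum_univ_four] at hw
  rw [eq_vec_four I]
  -- Sixteen patterns remain. A pair 11 vanishes by antisymmetry, one index 1 in each pair gives the
  -- excluded weight -2, a single 1 reduces to `hB`, and no 1 is `hS`.
  rcases FrameIndex.eq_one_or_sp (hz 0) with h0 | ⟨i, h0⟩ <;>
  rcases FrameIndex.eq_one_or_sp (hz 1) with h1 | ⟨j, h1⟩ <;>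
  rcases FrameIndex.eq_one_or_sp (hz 2) with h2 | ⟨k, h2⟩ <;>
  rcases FrameIndex.eq_one_or_sp (hz 3) with h3 | ⟨l, h3⟩ <;>
  rw [h0, h1, h2, h3] at hw ⊢
  · exact hl _ _
  · exact hl _ _
  · exact hl _ _
  · exact hl _ _
  · exact hr _ _
  · exact absurd (by simp [FrameIndex.weight]) hw
  · exact absurd (by simp [FrameIndex.weight]) hw
  · exact hB _ _ _
  · exact hr _ _
  · exact absurd (by simp [FrameIndex.weight]) hw
  · exact absurd (by simp [FrameIndex.weight]) hw
  · rw [F.comp_left hs, hB, neg_zero]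
  · exact hr _ _
  · rw [F.comp_pair hs, hB]
  · rw [F.comp_pair hs, F.comp_left hs, hB, neg_zero]
  · exact hS _ _ _ _

end LowDimension

/-! ### From the manifold to its coordinate charts -/

section Manifold

variable {n : ℕ} {M : Type*} [TopologicalSpace M] [ChartedSpace (Coord n) M]

/-- The differentials of a chart and of its inverse are mutually inverse. This identifies the metric
and ℓ on M with their coordinate representatives. -/
theorem sum_vecComp_smul_coordVec [IsManifold (𝓡 n) ∞ M] {e : OpenPartialHomeomorph M (Coord n)}
    (he : e ∈ atlas (Coord n) M) {y : Coord n} (hy : y ∈ e.target)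
    (v : TangentSpace (𝓡 n) (e.symm y)) :
    ∑ i, vecComp e (e.symm y) v i • coordVec e y i = v := by
  have : IsManifold (𝓡 n) 1 M := IsManifold.of_le (n := ∞) (by simp)
  have h1 := (mdifferentiable_of_mem_atlas (I := 𝓡 n) he).symm_comp_deriv (e.map_target hy)
  rw [e.right_inv hy] at h1
  let L : Coord n →L[ℝ] TangentSpace (𝓡 n) (e.symm y) := mfderiv (𝓡 n) (𝓡 n) e.symm y
  let w : Coord n := mfderiv (𝓡 n) (𝓡 n) e (e.symm y) v
  have h2 : L w = v := DFunLike.congr_fun h1 v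
  have h3 : w = ∑ i, w i • (EuclideanSpace.single i (1 : ℝ) : Coord n) := by
    ext j
    simp [Pi.single_apply]
  calc ∑ i, vecComp e (e.symm y) v i • coordVec e y i
      = ∑ i, w i • L (EuclideanSpace.single i (1 : ℝ)) := rfl
    _ = L (∑ i, w i • (EuclideanSpace.single i (1 : ℝ) : Coord n)) := by
        rw [map_sum]
        exact Finset.sum_congr rfl fun i _ => (L.map_smul _ _).symm
    _ = v := by rw [← h3, h2]

theorem dot_vecComp [IsManifold (𝓡 n) ∞ M] (g : LorentzMetric n M)
    {e : OpenPartialHomeomorph M (Coord n)} (he : e ∈ atlas (Coord n) M) {y : Coord n}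
    (hy : y ∈ e.target) (u v : TangentSpace (𝓡 n) (e.symm y)) :
    dot (g.coord e y) (vecComp e (e.symm y) u) (vecComp e (e.symm y) v)
      = g.val (e.symm y) u v := by
  conv_rhs => rw [← sum_vecComp_smul_coordVec he hy u, ← sum_vecComp_smul_coordVec he hy v]
  simp only [map_sum, LinearMap.sum_apply, map_smul, LinearMap.smul_apply, smul_eq_mul, dot,
    LorentzMetric.coord, Matrix.of_apply, Finset.mul_sum]
  rw [Finset.sum_comm]
  refine Finset.sum_congr rfl fun a _ => Finset.sum_congr rfl fun b _ => ?_
  ring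

theorem LorentzMetric.exists_coord_basis [IsManifold (𝓡 n) ∞ M] (g : LorentzMetric n M)
    {e : OpenPartialHomeomorph M (Coord n)} (he : e ∈ atlas (Coord n) M) {y : Coord n}
    (hy : y ∈ e.target) : ∃ B : Fin n → Fin n → ℝ, ∀ i j,
      dot (g.coord e y) (B i) (B j) = if i = j then (if (i : ℕ) = 0 then -1 else 1) else 0 := by
  obtain ⟨b, hb⟩ := g.lorentzian (e.symm y)
  exact ⟨fun i => vecComp e (e.symm y) (b i), fun i j => by rw [dot_vecComp g he hy, hb]⟩

theorem det_ne_zero_of_basis {G : Matrix (Fin n) (Fin n) ℝ} {B : Fin n → Fin n → ℝ}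
    (hB : ∀ i j, dot G (B i) (B j) = if i = j then (if (i : ℕ) = 0 then -1 else 1) else 0) :
    G.det ≠ 0 := by
  have h : Matrix.of B * G * (Matrix.of B).transpose
      = Matrix.diagonal fun i : Fin n => if (i : ℕ) = 0 then (-1 : ℝ) else 1 := by
    ext i j
    rw [Matrix.diagonal_apply, ← hB, dot_eq_dotProduct, Matrix.mul_assoc]
    rfl
  intro h0
  have h1 := congrArg Matrix.det h
  rw [Matrix.det_mul, Matrix.det_mul, h0, mul_zero, zero_mul, Matrix.det_diagonal] at h1
  refine Finset.prod_ne_zero_iff.2 (fun i _ => ?_) h1.symm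
  split_ifs <;> norm_num

theorem LorentzMetric.isMetricOn [IsManifold (𝓡 n) ∞ M] (g : LorentzMetric n M)
    {e : OpenPartialHomeomorph M (Coord n)} (he : e ∈ atlas (Coord n) M) :
    IsMetricOn (g.coord e) e.target where
  isOpen := e.open_target
  smooth := g.smooth e he
  symm y a b := g.symm _ _ _
  det_ne_zero y hy := by
    obtain ⟨B, hB⟩ := g.exists_coord_basis he hy
    exact det_ne_zero_of_basis hB

theorem IsCCNV.isParallelOn {g : LorentzMetric n M} {ℓ : ∀ p : M, TangentSpace (𝓡 n) p}
    (hℓ : IsCCNV g ℓ) {e : OpenPartialHomeomorph M (Coord n)} (he : e ∈ atlas (Coord n) M) :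
    IsParallelOn (g.coord e) (fieldComp e ℓ) e.target :=
  ⟨hℓ.smooth e he, hℓ.parallel e he⟩

theorem IsCCNV.fieldComp_ne_zero [IsManifold (𝓡 n) ∞ M] {g : LorentzMetric n M}
    {ℓ : ∀ p : M, TangentSpace (𝓡 n) p} (hℓ : IsCCNV g ℓ)
    {e : OpenPartialHomeomorph M (Coord n)} (he : e ∈ atlas (Coord n) M) {y : Coord n}
    (hy : y ∈ e.target) : fieldComp e ℓ y ≠ 0 := by
  intro h
  refine hℓ.ne_zero (e.symm y) ?_
  rw [← sum_vecComp_smul_coordVec he hy (ℓ (e.symm y))]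
  refine Finset.sum_eq_zero fun i _ => ?_
  have h1 : vecComp e (e.symm y) (ℓ (e.symm y)) i = 0 := congrFun h i
  rw [h1, zero_smul]

theorem IsCCNV.dot_fieldComp [IsManifold (𝓡 n) ∞ M] {g : LorentzMetric n M}
    {ℓ : ∀ p : M, TangentSpace (𝓡 n) p} (hℓ : IsCCNV g ℓ)
    {e : OpenPartialHomeomorph M (Coord n)} (he : e ∈ atlas (Coord n) M) {y : Coord n}
    (hy : y ∈ e.target) : dot (g.coord e y) (fieldComp e ℓ y) (fieldComp e ℓ y) = 0 :=
  (dot_vecComp g he hy _ _).trans (hℓ.null _)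

end Manifold

/-! ## Ricci and Weyl tensors -/

theorem KilledBy.sum_eq_zero {n k : ℕ} {v : Fin n → ℝ} {T : Tensor n k} (h : KilledBy v T)
    (t : Fin k → Fin n) (r : Fin k) : ∑ e, v e * T (Function.update t r e) = 0 := by
  rw [← ev_update_single]
  exact h _ r (by simp)

theorem ev_two {n : ℕ} (T : Tensor n 2) (V : Fin 2 → Fin n → ℝ) :
    ev T V = dot (Matrix.of fun a b => T ![a, b]) (V 0) (V 1) := by
  rw [ev_apply, ← (finTwoArrowEquiv (Fin n)).symm.sum_comp, Fintype.sum_prod_type]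
  simp only [dot, Matrix.of_apply]
  refine Finset.sum_congr rfl fun a _ => Finset.sum_congr rfl fun b _ => ?_
  simp [Fin.prod_univ_two, mul_assoc]

section Weyl

variable {n : ℕ} {g : MetricField n} {U : Set (Coord n)} {y : Coord n} {X : Coord n → Fin n → ℝ}

theorem IsMetricOn.inv_symm (hg : IsMetricOn g U) (y : Coord n) (a b : Fin n) :
    (g y)⁻¹ a b = (g y)⁻¹ b a := by
  have h : (g y).IsSymm := Matrix.IsSymm.ext fun i j => hg.symm y j i
  have h2 : ((g y)⁻¹).transpose = (g y)⁻¹ := by rw [Matrix.transpose_nonsing_inv, h]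
  exact congrFun (congrFun h2.symm a) b

/-- As a metric trace of the lowered tensor, Ricci inherits its symmetry and its annihilation by X
from Riemann, and Ricci-flatness becomes tracefreeness. -/
theorem IsMetricOn.ricci_eq (hg : IsMetricOn g U) (hy : y ∈ U) (a b : Fin n) :
    ricci g y ![a, b] = ∑ c, ∑ d, (g y)⁻¹ c d * riemann g y ![c, a, d, b] := by
  rw [Finset.sum_comm]
  refine Finset.sum_congr rfl fun d _ => ?_
  have h := congrFun (congrArg (fun M => Matrix.mulVec M fun e => riemannUp g e a d b y)
    (hg.inv_mul hy)) d
  simp only [Matrix.one_mulVec, ← Matrix.mulVec_mulVec] at h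
  refine h.symm.trans ?_
  simp only [Matrix.mulVec, dotProduct]
  refine Finset.sum_congr rfl fun c _ => ?_
  rw [hg.inv_symm y d c]
  rfl

theorem IsMetricOn.ricci_symm (hg : IsMetricOn g U) (hy : y ∈ U) (a b : Fin n) :
    ricci g y ![a, b] = ricci g y ![b, a] := by
  rw [hg.ricci_eq hy, hg.ricci_eq hy, Finset.sum_comm]
  refine Finset.sum_congr rfl fun c _ => Finset.sum_congr rfl fun d _ => ?_
  rw [hg.inv_symm y d c, hg.riemann_pair_symm hy d]

theorem sum_ricci_mul (hg : IsMetricOn g U) (hX : IsParallelOn g X U) (hy : y ∈ U) (a : Fin n) :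
    ∑ b, ricci g y ![a, b] * X y b = 0 := by
  have hk := killedBy_riemann hg hX hy
  have h : ∀ c d, ∑ b, X y b * riemann g y ![c, a, d, b] = 0 := fun c d => by
    rw [← hk.sum_eq_zero ![c, a, d, d] 3]
    refine Finset.sum_congr rfl fun b _ => ?_
    congr 2
    funext i; fin_cases i <;> rfl
  simp only [hg.ricci_eq hy, Finset.sum_mul]
  rw [Finset.sum_comm]
  refine Finset.sum_eq_zero fun c _ => ?_
  rw [Finset.sum_comm]
  refine Finset.sum_eq_zero fun d _ => ?_
  calc _ = (g y)⁻¹ c d * ∑ b, X y b * riemann g y ![c, a, d, b] := by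
        rw [Finset.mul_sum]; exact Finset.sum_congr rfl fun b _ => by ring
    _ = 0 := by rw [h, mul_zero]

theorem killedBy_ricci (hg : IsMetricOn g U) (hX : IsParallelOn g X U) (hy : y ∈ U) :
    KilledBy (X y) (ricci g y) := by
  have h1 : ∀ u, dot (Matrix.of fun a b => ricci g y ![a, b]) u (X y) = 0 := fun u => by
    simp only [dot, Matrix.of_apply]
    refine Finset.sum_eq_zero fun a _ => ?_
    calc _ = u a * ∑ b, ricci g y ![a, b] * X y b := by
          rw [Finset.mul_sum]; exact Finset.sum_congr rfl fun b _ => by ring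
      _ = 0 := by rw [sum_ricci_mul hg hX hy, mul_zero]
  intro V r hV
  rw [ev_two]
  fin_cases r
  · rw [dot_comm (G := Matrix.of fun a b => ricci g y ![a, b])
      (fun a b => hg.ricci_symm hy a b)]
    rw [show V 0 = X y from hV]
    exact h1 _
  · rw [show V 1 = X y from hV]
    exact h1 _

theorem sum_four_mul (A B : Matrix (Fin n) (Fin n) ℝ) (u v w x : Fin n → ℝ) :
    ∑ a, ∑ b, ∑ c, ∑ d, A a c * B b d * (u a * v b * w c * x d) = dot A u w * dot B v x := by
  simp only [dot, Finset.sum_mul_sum]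
  refine Finset.sum_congr rfl fun a _ => Finset.sum_congr rfl fun b _ => ?_
  exact Finset.sum_congr rfl fun c _ => Finset.sum_congr rfl fun d _ => by ring

theorem sum_four_mul' (A B : Matrix (Fin n) (Fin n) ℝ) (u v w x : Fin n → ℝ) :
    ∑ a, ∑ b, ∑ c, ∑ d, A a d * B b c * (u a * v b * w c * x d) = dot A u x * dot B v w := by
  rw [← sum_four_mul]
  refine Finset.sum_congr rfl fun a _ => Finset.sum_congr rfl fun b _ => ?_
  rw [Finset.sum_comm]
  exact Finset.sum_congr rfl fun c _ => Finset.sum_congr rfl fun d _ => by ring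

theorem ev_weyl (g : MetricField n) (y : Coord n) (V : Fin 4 → Fin n → ℝ) :
    ev (weyl g y) V = ev (riemann g y) V
      - (1 / ((n : ℝ) - 2)) *
        (dot (g y) (V 0) (V 2) * ev (ricci g y) ![V 1, V 3]
          - dot (g y) (V 0) (V 3) * ev (ricci g y) ![V 1, V 2]
          - dot (g y) (V 1) (V 2) * ev (ricci g y) ![V 0, V 3]
          + dot (g y) (V 1) (V 3) * ev (ricci g y) ![V 0, V 2])
      + (scalarCurvature g y / (((n : ℝ) - 1) * ((n : ℝ) - 2))) *
        (dot (g y) (V 0) (V 2) * dot (g y) (V 1) (V 3)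
          - dot (g y) (V 0) (V 3) * dot (g y) (V 1) (V 2)) := by
  let R : Matrix (Fin n) (Fin n) ℝ := Matrix.of fun a b => ricci g y ![a, b]
  have hR : ∀ u v, ev (ricci g y) ![u, v] = dot R u v := fun u v => ev_two _ _
  simp only [hR]
  rw [mul_comm (dot (g y) (V 1) (V 2)), mul_comm (dot (g y) (V 1) (V 3)) (dot R _ _),
    ← sum_four_mul, ← sum_four_mul', ← sum_four_mul', ← sum_four_mul, ← sum_four_mul,
    ← sum_four_mul', ev_four, ev_four]
  simp only [← Finset.sum_sub_distrib, ← Finset.sum_add_distrib, Finset.mul_sum]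
  refine Finset.sum_congr rfl fun a _ => Finset.sum_congr rfl fun b _ =>
    Finset.sum_congr rfl fun c _ => Finset.sum_congr rfl fun d _ => ?_
  simp only [weyl, R, Matrix.of_apply, Matrix.cons_val_zero, Matrix.cons_val_one, Matrix.cons_val]
  ring

theorem weyl_eq_riemann (h : ricci g y = 0) : weyl g y = riemann g y := by
  funext s
  simp [weyl, scalarCurvature, h]

theorem curvatureSymm_riemann (hg : IsMetricOn g U) (hy : y ∈ U) : CurvatureSymm (riemann g y) :=
  ⟨hg.riemann_antisymm_left hy, IsMetricOn.riemann_antisymm_right y, hg.riemann_pair_symm hy⟩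

/-- In a null frame with `l` parallel the Weyl tensor has no components of positive boost weight. -/
theorem weightsIn_weyl (hg : IsMetricOn g U) (hX : IsParallelOn g X U) (hy : y ∈ U)
    (F : NullFrame (g y)) (hF : F.l = X y) : F.WeightsIn (weyl g y) (Set.Iic 0) := by
  intro I hI
  by_contra hw
  rw [Set.mem_Iic, not_le] at hw
  refine hI ?_
  have hk : KilledBy F.l (riemann g y) := by rw [hF]; exact killedBy_riemann hg hX hy
  have hkr : KilledBy F.l (ricci g y) := by rw [hF]; exact killedBy_ricci hg hX hy
  obtain ⟨r, hr⟩ := exists_eq_zero_of_boostWeight_pos hw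
  have hric : ∀ J K : FrameIndex n, 0 < J.weight + K.weight →
      ev (ricci g y) ![F.vec J, F.vec K] = 0 := by
    intro J K hJK
    by_cases hJ : J = .zero
    · exact hkr _ 0 (by rw [hJ]; rfl)
    · by_cases hK : K = .zero
      · exact hkr _ 1 (by rw [hK]; rfl)
      · have h1 := FrameIndex.weight_nonpos hJ
        have h2 := FrameIndex.weight_nonpos hK
        omega
  rw [boostWeight, Fin.sum_univ_four] at hw
  -- The metric is nonzero only on indices of opposite weight, so in a product g·Ric the positive
  -- weight falls entirely on Ricci.
  have hgr : ∀ A B J K : FrameIndex n, 0 < A.weight + B.weight + J.weight + K.weight →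
      dot (g y) (F.vec A) (F.vec B) * ev (ricci g y) ![F.vec J, F.vec K] = 0 := by
    intro A B J K h
    by_cases hd : dot (g y) (F.vec A) (F.vec B) = 0
    · rw [hd, zero_mul]
    · have := F.weight_of_dot_ne_zero (hg.symm y) hd
      rw [hric J K (by omega), mul_zero]
  have hgg : ∀ A B J K : FrameIndex n, 0 < A.weight + B.weight + J.weight + K.weight →
      dot (g y) (F.vec A) (F.vec B) * dot (g y) (F.vec J) (F.vec K) = 0 := by
    intro A B J K h
    by_contra hd
    have h1 := F.weight_of_dot_ne_zero (hg.symm y) (left_ne_zero_of_mul hd)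
    have h2 := F.weight_of_dot_ne_zero (hg.symm y) (right_ne_zero_of_mul hd)
    omega
  rw [NullFrame.comp_eq_ev, ev_weyl, hk _ r (by rw [hr]; rfl), hgr _ _ _ _ (by omega),
    hgr _ _ _ _ (by omega), hgr _ _ _ _ (by omega), hgr _ _ _ _ (by omega),
    hgg _ _ _ _ (by omega), hgg _ _ _ _ (by omega)]
  ring

/-- The Riemann term of Φ_{ij} vanishes since its first index is 0; what remains is Ricci on m_i,
m_j and multiples of δ_{ij}, all symmetric. -/
theorem subD_weyl (hg : IsMetricOn g U) (hX : IsParallelOn g X U) (hy : y ∈ U)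
    (F : NullFrame (g y)) (hF : F.l = X y) : F.SubD (weyl g y) := by
  have hk : KilledBy F.l (riemann g y) := by rw [hF]; exact killedBy_riemann hg hX hy
  have h : ∀ i j, F.Phi2 (weyl g y) i j
      = - (1 / ((n : ℝ) - 2)) * ev (ricci g y) ![F.m i, F.m j]
        - (1 / ((n : ℝ) - 2)) * (if i = j then 1 else 0) * ev (ricci g y) ![F.l, F.nn]
        + scalarCurvature g y / (((n : ℝ) - 1) * ((n : ℝ) - 2)) * (if i = j then 1 else 0) := by
    intro i j
    rw [NullFrame.Phi2, NullFrame.comp_eq_ev, ev_weyl, hk _ 0 rfl]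
    simp only [Matrix.cons_val_zero, Matrix.cons_val_one, Matrix.cons_val, NullFrame.vec, F.l_nn,
      F.l_m, F.m_m, dot_comm (hg.symm y) (F.m i) F.nn, F.nn_m]
    ring
  intro i j
  rw [h, h]
  have h1 : ev (ricci g y) ![F.m i, F.m j] = ev (ricci g y) ![F.m j, F.m i] := by
    rw [ev_two, ev_two]
    exact dot_comm (fun a b => hg.ricci_symm hy a b) _ _
  rw [h1]
  simp only [eq_comm (a := i) (b := j)]
  ring

end Weyl

end PPWave

/-! ### Assembly of the four claims -/

theorem mainTheorem1 {n : ℕ} (hn : 4 ≤ n) {M : Type*} [TopologicalSpace M]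
    [ChartedSpace (PPWave.Coord n) M] [IsManifold (𝓡 n) ∞ M]
    (g : PPWave.LorentzMetric n M) (ℓ : ∀ p : M, TangentSpace (𝓡 n) p)
    (hℓ : PPWave.IsCCNV g ℓ) :
    -- Weyl type II(d) and Ricci type II (or more special) along `ℓ`, and `R_{ab} ℓ^b = 0`
    (∀ e ∈ atlas (PPWave.Coord n) M, ∀ y ∈ e.target,
      (∃ F : PPWave.NullFrame (g.coord e y),
        F.l = PPWave.fieldComp e ℓ y ∧
        F.WeightsIn (PPWave.weyl (g.coord e) y) (Set.Iic 0) ∧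
        F.SubD (PPWave.weyl (g.coord e) y) ∧
        F.WeightsIn (PPWave.ricci (g.coord e) y) (Set.Iic 0)) ∧
      ∀ a, ∑ b, PPWave.ricci (g.coord e) y ![a, b] * PPWave.fieldComp e ℓ y b = 0) ∧
    -- nowhere properly Einstein
    (∀ e ∈ atlas (PPWave.Coord n) M, ∀ y ∈ e.target,
      ¬ ((∀ a b, PPWave.ricci (g.coord e) y ![a, b]
            = PPWave.scalarCurvature (g.coord e) y / n * g.coord e y a b) ∧
          PPWave.scalarCurvature (g.coord e) y ≠ 0)) ∧
    -- genuine Weyl types in the Ricci-flat case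
    (PPWave.IsRicciFlat g →
      ∀ e ∈ atlas (PPWave.Coord n) M, ∀ y ∈ e.target, PPWave.weyl (g.coord e) y ≠ 0 →
        (n = 4 → PPWave.TypeN (g.coord e y) (PPWave.weyl (g.coord e) y)) ∧
        (n = 5 → PPWave.GenuineTypeIIIa (g.coord e y) (PPWave.weyl (g.coord e) y) ∨
          PPWave.TypeN (g.coord e y) (PPWave.weyl (g.coord e) y)) ∧
        (6 ≤ n → PPWave.GenuineTypeII'abd (g.coord e y) (PPWave.weyl (g.coord e) y) ∨
          PPWave.TypeDabd (g.coord e y) (PPWave.weyl (g.coord e) y) ∨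
          PPWave.GenuineTypeIIIa (g.coord e y) (PPWave.weyl (g.coord e) y) ∨
          PPWave.TypeN (g.coord e y) (PPWave.weyl (g.coord e) y))) ∧
    -- Ricci-flat of type III(a)/N (or zero Weyl tensor) at each point implies VSI
    (PPWave.IsRicciFlat g →
      (∀ e ∈ atlas (PPWave.Coord n) M, ∀ y ∈ e.target,
        PPWave.weyl (g.coord e) y = 0 ∨
        PPWave.TypeIIIa (g.coord e y) (PPWave.weyl (g.coord e) y) ∨
        PPWave.TypeN (g.coord e y) (PPWave.weyl (g.coord e) y)) →
      PPWave.IsVSI g) := by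
  have hn2 : 2 ≤ n := by omega
  have hdata : ∀ e ∈ atlas (PPWave.Coord n) M, ∀ y ∈ e.target,
      ∃ F : PPWave.NullFrame (g.coord e y), F.l = PPWave.fieldComp e ℓ y := by
    intro e he y hy
    obtain ⟨B, hB⟩ := g.exists_coord_basis he hy
    exact PPWave.NullFrame.exists_nullFrame hn2 ((g.isMetricOn he).symm y) B hB
      (hℓ.fieldComp_ne_zero he hy) (hℓ.dot_fieldComp he hy)
  have hk : ∀ e ∈ atlas (PPWave.Coord n) M, ∀ y ∈ e.target,
      PPWave.KilledBy (PPWave.fieldComp e ℓ y) (PPWave.riemann (g.coord e) y) :=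
    fun e he y hy => PPWave.killedBy_riemann (g.isMetricOn he) (hℓ.isParallelOn he) hy
  refine ⟨fun e he y hy => ⟨?_, fun a =>
    PPWave.sum_ricci_mul (g.isMetricOn he) (hℓ.isParallelOn he) hy a⟩, ?_, ?_, ?_⟩
  · obtain ⟨F, hF⟩ := hdata e he y hy
    refine ⟨F, hF, PPWave.weightsIn_weyl (g.isMetricOn he) (hℓ.isParallelOn he) hy F hF,
      PPWave.subD_weyl (g.isMetricOn he) (hℓ.isParallelOn he) hy F hF,
      PPWave.weightsIn_of_killedBy F ?_⟩
    rw [hF]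
    exact PPWave.killedBy_ricci (g.isMetricOn he) (hℓ.isParallelOn he) hy
  · rintro e he y hy ⟨hE, hR⟩
    have hc : PPWave.scalarCurvature (g.coord e) y / n ≠ 0 :=
      div_ne_zero hR (Nat.cast_ne_zero.2 (by omega))
    -- In the Einstein case R_{ab} ℓ^b = 0 becomes g_{ab} ℓ^b = 0, contradicting g(N, ℓ) = 1.
    obtain ⟨N, hN⟩ := (g.isMetricOn he).exists_dot_eq_one hy (hℓ.fieldComp_ne_zero he hy)
    rw [PPWave.dot_comm ((g.isMetricOn he).symm y)] at hN
    refine one_ne_zero (α := ℝ) ?_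
    rw [← hN]
    refine Finset.sum_eq_zero fun a _ => ?_
    have h := PPWave.sum_ricci_mul (g.isMetricOn he) (hℓ.isParallelOn he) hy a
    simp only [hE, mul_assoc, ← Finset.mul_sum] at h
    calc _ = N a * ∑ b, g.coord e y a b * PPWave.fieldComp e ℓ y b := by
          rw [Finset.mul_sum]; exact Finset.sum_congr rfl fun b _ => by ring
      _ = 0 := by rw [(mul_eq_zero.1 h).resolve_left hc, mul_zero]
  · intro hRF e he y hy
    rw [PPWave.weyl_eq_riemann (hRF e he y hy)]
    intro h0
    obtain ⟨F, hF⟩ := hdata e he y hy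
    have hG := (g.isMetricOn he).symm y
    have hv := hℓ.fieldComp_ne_zero he hy
    have hvv := hℓ.dot_fieldComp he hy
    have hkv := hk e he y hy
    have hkF : PPWave.KilledBy F.l (PPWave.riemann (g.coord e) y) := by rw [hF]; exact hkv
    have hs := PPWave.curvatureSymm_riemann (g.isMetricOn he) hy
    have htr : ∀ a b, ∑ c, ∑ d, (g.coord e y)⁻¹ c d
        * PPWave.riemann (g.coord e) y ![c, a, d, b] = 0 := fun a b => by
      rw [← (g.isMetricOn he).ricci_eq hy, hRF e he y hy]
      rfl
    have hIII : PPWave.TypeIII (g.coord e y) (PPWave.riemann (g.coord e) y) →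
        PPWave.GenuineTypeIIIa (g.coord e y) (PPWave.riemann (g.coord e) y) ∨
          PPWave.TypeN (g.coord e y) (PPWave.riemann (g.coord e) y) := by
      intro h
      by_cases hN : PPWave.TypeN (g.coord e y) (PPWave.riemann (g.coord e) y)
      · exact Or.inr hN
      · exact Or.inl ⟨h.typeIIIa hn2 hG hv hvv hkv, hN⟩
    refine ⟨fun h4 => PPWave.typeN_of_dim_four h4 hG F hkF hs htr h0,
      fun h5 => hIII (PPWave.typeIII_of_dim_five h5 hG F hkF hs htr h0), fun _ => ?_⟩
    -- Genuineness comes from excluded middle: type III and then type D are split off, and II'(abd)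
    -- holds in any case.
    by_cases h3 : PPWave.TypeIII (g.coord e y) (PPWave.riemann (g.coord e) y)
    · exact Or.inr (Or.inr (hIII h3))
    · by_cases hD : PPWave.TypeD (g.coord e y) (PPWave.riemann (g.coord e) y)
      · exact Or.inr (Or.inl (hD.typeDabd hn2 hG hv hvv hkv))
      · exact Or.inl ⟨PPWave.typeII'abd_of_killedBy F hkF h0, hD, h3⟩
  · intro hRF hW e he p I hI y hy
    -- Required on the whole chart domain rather than at y alone, because the property has to be
    -- differentiated.
    have hperp : ∀ z ∈ e.target, PPWave.VanishesOnPerp (g.coord e z) (PPWave.fieldComp e ℓ z)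
        (PPWave.riemann (g.coord e) z) := by
      intro z hz
      have hIII : PPWave.weyl (g.coord e) z = 0 ∨
          PPWave.TypeIII (g.coord e z) (PPWave.weyl (g.coord e) z) := by
        rcases hW e he z hz with h | h | h
        · exact Or.inl h
        · exact Or.inr h.typeIII
        · exact Or.inr h.typeIII
      rw [PPWave.weyl_eq_riemann (hRF e he z hz)] at hIII
      rcases hIII with h | ⟨_, F, hF⟩
      · intro V _
        rw [h, PPWave.ev_zero]
      · exact F.vanishesOnPerp_of_weightsIn hn2 ((g.isMetricOn he).symm z) hF
          (hℓ.fieldComp_ne_zero he hz) (hℓ.dot_fieldComp he hz) (hk e he z hz)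
    obtain ⟨F, hF⟩ := hdata e he y hy
    have hzero : ∀ J ∈ PPWave.curvatureInvariants (g.coord e) p, J y = 0 := by
      intro J hJ
      refine Submodule.span_induction ?_ rfl ?_ ?_ hJ
      · rintro _ ⟨m, q, k, σ, hm, _, rfl⟩
        refine PPWave.contraction_eq_zero hn2 ((g.isMetricOn he).symm y) F hm k ?_ ?_ σ
        · intro i
          rw [hF]
          exact (PPWave.killedBy_riemannDeriv (g.isMetricOn he) (hℓ.isParallelOn he) (k i)).1 y hy
        · intro i
          rw [hF]
          exact PPWave.vanishesOnPerp_riemannDeriv (g.isMetricOn he) (hℓ.isParallelOn he)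
            (fun z hz => hℓ.fieldComp_ne_zero he hz) hperp (k i) y hy
      · intro a b _ _ ha hb
        rw [Pi.add_apply, ha, hb, add_zero]
      · intro c a _ ha
        rw [Pi.smul_apply, ha, smul_zero]
    exact hzero I hI
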